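/- For a finite family of finite sets put $$d_{\rm sum}(U_1,\dots,U_r)=\sum_{1\le i<j\le r}\bigl(|U_i\setminus U_j|+|U_j\setminus U_i|\bigr).$$ Theorem. There is a polynomial-time algorithm that, given a finite matroid $\mathcal M=(E,\mathcal I)$ by an independence oracle, and an integer $r\ge 0$, finds $r$ (not necessarily distinct) bases $B_1,\dots,B_r$ of $\mathcal M$ maximizing $d_{\rm sum}(B_1,\dots,B_r)$ over all $r$-tuples of bases of $\mathcal M$. Here the algorithm is a single random access machine program, with registers and arrays of natural numbers and with addition, truncated subtraction, indexed array access and comparison with zero, but no multiplication, as unit-cost operations. Its input is $n=|E|$ and $r$, the elements of $E$ being numbered in an arbitrary fixed way. It can ask the oracle whether a subset of $E$, presented by its indicator vector, belongs to $\mathcal I$, and each such call is charged $Q$ steps in addition to one step for issuing it. It outputs the indicator vectors of $B_1,\dots,B_r$. Polynomial time means that the total number of steps is at most $p(|E|+r+Q)$ for one fixed polynomial $p$ (independent of $\mathcal M$, $r$ and $Q$); in particular, if membership in $\mathcal I$ can be checked in time polynomial in $|E|$, then the running time is polynomial in $|E|$ and $r$. -/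

import Mathlib

/-!
# Oracle programs with a step count

The machine model is the structured random access machine: finitely many registers and arrays of
natural numbers, addition, truncated subtraction, indirect access, conditionals and loops, together
with calls to an oracle. Multiplication is not a primitive, so that a number computed in `t` steps
has at most `O(t)` bits more than the largest number initially present, and step counts agree with
Turing machine time up to a polynomial.
-/

namespace OracleProgram

/-- The state of the machine: registers `reg x` and arrays `arr k`, with cells `arr k a`. -/
structure State where
  reg : ℕ → ℕ
  arr : ℕ → ℕ → ℕ

/-- Overwrite register `x`. -/
def State.setReg (s : State) (x v : ℕ) : State :=
  { s with reg := Function.update s.reg x v }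

/-- Overwrite cell `a` of array `k`. -/
def State.setCell (s : State) (k a v : ℕ) : State :=
  { s with arr := Function.update s.arr k (Function.update (s.arr k) a v) }

/-- Arithmetic expressions: constants, registers, sums, truncated differences, and the cell of
array `k` whose address is the value of an expression. -/
inductive Expr where
  | const (c : ℕ)
  | reg (x : ℕ)
  | add (a b : Expr)
  | sub (a b : Expr)
  | cell (k : ℕ) (a : Expr)

/-- The value of an expression. -/
def Expr.eval (s : State) : Expr → ℕ
  | .const c => c
  | .reg x => s.reg x
  | .add a b => a.eval s + b.eval s
  | .sub a b => a.eval s - b.eval s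
  | .cell k a => s.arr k (a.eval s)

/-- The time needed to evaluate an expression: one step for every operation in it. -/
def Expr.cost : Expr → ℕ
  | .const _ => 1
  | .reg _ => 1
  | .add a b => a.cost + b.cost + 1
  | .sub a b => a.cost + b.cost + 1
  | .cell _ a => a.cost + 1

/-- Programs. A condition holds if its value is nonzero. `query x k` submits array `k` to the
oracle and puts the answer (`1` for yes, `0` for no) into register `x`. -/
inductive Program where
  | skip
  | assign (x : ℕ) (a : Expr)
  | store (k : ℕ) (i a : Expr)
  | query (x k : ℕ)
  | seq (p q : Program)
  | cond (b : Expr) (p q : Program)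
  | loop (b : Expr) (p : Program)

/-- `Exec ask Q p s s' t`: with an oracle that answers according to `ask` and takes `Q` steps for
every answer, program `p` started in state `s` halts in state `s'` after exactly `t` steps. -/
inductive Exec (ask : (ℕ → ℕ) → Prop) (Q : ℕ) : Program → State → State → ℕ → Prop
  | skip (s : State) : Exec ask Q .skip s s 1
  | assign (s : State) (x : ℕ) (a : Expr) :
      Exec ask Q (.assign x a) s (s.setReg x (a.eval s)) (1 + a.cost)
  | store (s : State) (k : ℕ) (i a : Expr) :
      Exec ask Q (.store k i a) s (s.setCell k (i.eval s) (a.eval s)) (1 + i.cost + a.cost)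
  | queryYes (s : State) (x k : ℕ) (h : ask (s.arr k)) :
      Exec ask Q (.query x k) s (s.setReg x 1) (1 + Q)
  | queryNo (s : State) (x k : ℕ) (h : ¬ ask (s.arr k)) :
      Exec ask Q (.query x k) s (s.setReg x 0) (1 + Q)
  | seq {p q : Program} {s s₁ s₂ : State} {t₁ t₂ : ℕ}
      (h₁ : Exec ask Q p s s₁ t₁) (h₂ : Exec ask Q q s₁ s₂ t₂) :
      Exec ask Q (.seq p q) s s₂ (t₁ + t₂)
  | condTrue {b : Expr} {p q : Program} {s s₁ : State} {t : ℕ}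
      (hb : b.eval s ≠ 0) (h : Exec ask Q p s s₁ t) :
      Exec ask Q (.cond b p q) s s₁ (1 + b.cost + t)
  | condFalse {b : Expr} {p q : Program} {s s₁ : State} {t : ℕ}
      (hb : b.eval s = 0) (h : Exec ask Q q s s₁ t) :
      Exec ask Q (.cond b p q) s s₁ (1 + b.cost + t)
  | loopTrue {b : Expr} {p : Program} {s s₁ s₂ : State} {t₁ t₂ : ℕ}
      (hb : b.eval s ≠ 0) (h₁ : Exec ask Q p s s₁ t₁) (h₂ : Exec ask Q (.loop b p) s₁ s₂ t₂) :
      Exec ask Q (.loop b p) s s₂ (1 + b.cost + t₁ + t₂)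
  | loopFalse {b : Expr} {p : Program} {s : State} (hb : b.eval s = 0) :
      Exec ask Q (.loop b p) s s (1 + b.cost)

/-- The initial state on input `(n, r)`: register `0` holds `n`, register `1` holds `r`, and
everything else is zero. -/
def initial (n r : ℕ) : State where
  reg := fun x => if x = 0 then n else if x = 1 then r else 0
  arr := fun _ _ => 0

end OracleProgram

/-- The set of those elements `e 0, …, e (n - 1)` whose indicator in the array `a` is nonzero. -/
def decodeSet {α : Type*} {E : Set α} {n : ℕ} (e : Fin n ≃ E) (a : ℕ → ℕ) : Set α :=
  {x | ∃ j : Fin n, (e j : α) = x ∧ a j ≠ 0}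

/-- The independence oracle of `M`, with respect to the numbering `e` of the ground set. -/
def independenceOracle {α : Type*} (M : Matroid α) {n : ℕ} (e : Fin n ≃ M.E) (a : ℕ → ℕ) : Prop :=
  M.Indep (decodeSet e a)

/-- The diversity `∑_{i < j} (|B i \ B j| + |B j \ B i|)` of a family of finite sets. -/
noncomputable def dSum {α : Type*} {r : ℕ} (B : Fin r → Set α) : ℕ :=
  ∑ i : Fin r, ∑ j ∈ Finset.Ioi i, ((B i \ B j).ncard + (B j \ B i).ncard)

/-- The `r` sets that a machine with output array `a` reports: row `i` of the output matrix, stored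
in the cells `i * n, …, i * n + n - 1`, is the indicator of the `i`-th set. -/
def outputSets {α : Type*} {E : Set α} {n : ℕ} (e : Fin n ≃ E) (r : ℕ) (a : ℕ → ℕ) :
    Fin r → Set α :=
  fun i => decodeSet e (fun j => a (i * n + j))

/-!
# Diversity maximization over the bases of a matroid

For bases `B 0, …, B (r - 1)` let `c v` be the number of them that contain the element `v`. The
diversity is `∑ v, c v * (r - c v)` (`dSum_eq`), and `∑ v, c v` is the same for all families of
bases, so maximizing the diversity means minimizing the potential `∑ v, c v ^ 2`. The algorithm is a
local search for this problem.

Consider the exchange graph, with an arc `u → v` whenever `u` can be exchanged for `v` in one of the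
bases (`Matroid.Exch`). For every level `k` a breadth-first search computes the distance of all
elements from the set of those with `c v ≥ k`.

If the search reaches an element `y` with `c y ≤ k - 2`, walk back from `y` along arcs on which the
distance drops by one, performing the exchange of every arc. The exchanges can be carried out one
after the other, starting at the far end, because an exchange along a tight arc `u → v` keeps the
distance labels valid and keeps the tight arcs nearer to the sources (`ValidLabel.swapFamily`,
`TightBelow.swapFamily`, which rest on `Matroid.Exch.exch_of_exch_insert` and
`Matroid.Exch.exch_insert_of_not_exch`). In total one unit of multiplicity moves from an element
with `c ≥ k` to `y`, so the potential drops (`WalkInv.sum_sq_lt`). As the potential is at most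
`n * r ^ 2`, there are polynomially many such improvements.

If no level admits an improvement, then the set `R k` of the elements reached at level `k` is closed
under arcs, contains `{v | c v ≥ k}` and is contained in `{v | c v ≥ k - 1}`. A base from which no
arc leaves `R k` spans the complement of `R k` by its part outside `R k`, hence meets `R k` in as few
elements as possible (`Matroid.IsBase.encard_sdiff_le_of_closed`). The function
`g v = 2 * #{k | v ∈ R k} - 1` lies in `{2 * c v - 1, 2 * c v + 1}`, so it is a subgradient of the
square function at `c v`; summing `c' v ^ 2 ≥ c v ^ 2 + g v * (c' v - c v)` over all `v` shows that
no other family has a smaller potential (`sum_mult_sq_le_of_balanced`).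

The program is written in a sublanguage with counting loops only (`OracleProgram.Code`), for which
the final state is given by a function and a polynomial bound for the running time can be read off
the code (`OracleProgram.Code.exists_exec`). The only other loop is the outermost one, which runs as
long as the potential drops (`OracleProgram.exists_exec_loop`). All of this is done for a matroid on
`0, …, n - 1`, to which the given matroid is transported by the numbering of its elements.
-/

/-! ### Exchange arcs of a base -/

/-- There is an exchange arc from `u` to `v` at the set `B` if `u` can be swapped for the new
element `v` without losing independence. -/
def Matroid.Exch {α : Type*} (M : Matroid α) (B : Set α) (u v : α) : Prop :=
  u ∈ B ∧ v ∉ B ∧ M.Indep (insert v (B \ {u}))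

namespace Matroid

variable {α : Type*} {M : Matroid α} {B : Set α} {a b u v : α}

theorem Exch.isBase (h : M.Exch B u v) (hB : M.IsBase B) : M.IsBase (insert v (B \ {u})) :=
  hB.exchange_isBase_of_indep h.2.1 h.2.2

theorem Exch.mem_ground (h : M.Exch B u v) : v ∈ M.E :=
  h.2.2.subset_ground (Set.mem_insert _ _)

theorem exch_iff_notMem_closure (hB : M.IsBase B) (hu : u ∈ B) (hv : v ∉ B) (hvE : v ∈ M.E) :
    M.Exch B u v ↔ v ∉ M.closure (B \ {u}) := by
  have hi : M.Indep (B \ {u}) := hB.indep.subset Set.sdiff_subset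
  rw [hi.notMem_closure_iff_of_notMem (fun h => hv h.1) hvE]
  exact ⟨fun h => h.2.2, fun h => ⟨hu, hv, h⟩⟩

/-- An exchange along `u → v` creates an arc `a → b` only if the two arcs `a → v` and `u → b`
(either of which may be degenerate) were present before. -/
theorem Exch.exch_of_exch_insert (hB : M.IsBase B) (h : M.Exch B u v)
    (h' : M.Exch (insert v (B \ {u})) a b) :
    M.Exch B a b ∨ ((a = v ∨ M.Exch B a v) ∧ (b = u ∨ M.Exch B u b)) := by
  obtain ⟨ha, hb, hi⟩ := h'
  have hbE : b ∈ M.E := hi.subset_ground (Set.mem_insert _ _)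
  have hvE := h.mem_ground
  obtain ⟨hu, hv, hj⟩ := h
  have hbv : b ≠ v := fun e => hb (Set.mem_insert_iff.2 (.inl e))
  have hbB : b ≠ u → b ∉ B := fun e hbB => hb (Set.mem_insert_of_mem _ ⟨hbB, e⟩)
  rcases eq_or_ne a v with rfl | hav
  · right
    refine ⟨.inl rfl, ?_⟩
    rcases eq_or_ne b u with rfl | hbu
    · exact .inl rfl
    · refine .inr ⟨hu, hbB hbu, hi.subset (Set.insert_subset_insert ?_)⟩
      exact fun x hx => ⟨Set.mem_insert_of_mem _ hx, fun e => hv (by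
        rw [Set.mem_singleton_iff] at e; exact e ▸ hx.1)⟩
  · have haB : a ∈ B ∧ a ≠ u := by
      rcases ha with rfl | ha
      · exact absurd rfl hav
      · exact ⟨ha.1, ha.2⟩
    have hvin : v ∈ insert v (B \ {u}) \ {a} := ⟨Set.mem_insert _ _, fun e => hav e.symm⟩
    rcases eq_or_ne b u with rfl | hbu
    · right
      refine ⟨.inr ⟨haB.1, hv, hi.subset ?_⟩, .inl rfl⟩
      rintro x (rfl | hx)
      · exact Set.mem_insert_of_mem _ hvin
      · rcases eq_or_ne x b with rfl | hxb
        · exact Set.mem_insert _ _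
        · exact Set.mem_insert_of_mem _ ⟨Set.mem_insert_of_mem _ ⟨hx.1, hxb⟩, hx.2⟩
    · have hbB := hbB hbu
      by_contra hcon
      simp only [not_or, not_and_or] at hcon
      obtain ⟨hab, hcon⟩ := hcon
      rw [exch_iff_notMem_closure hB haB.1 hbB hbE, not_not] at hab
      -- The set `I` that the new arc makes independent.
      set I := insert b (insert v (B \ {u}) \ {a}) with hI
      have hbI : b ∉ insert v (B \ {u}) \ {a} := fun h => hb h.1
      have hbcl : b ∉ M.closure (insert v (B \ {u}) \ {a}) :=
        ((hi.subset (Set.subset_insert _ _)).notMem_closure_iff_of_notMem hbI hbE).2 hi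
      rcases hcon with hc | hc
      · -- If `v` were spanned by `B - a` then `I`, which has as many elements as `B`, would be too.
        have hvcl : v ∈ M.closure (B \ {a}) := by
          by_contra hvcl
          exact hc.2 ((exch_iff_notMem_closure hB haB.1 hv hvE).2 hvcl)
        have hBase : M.IsBase I := by
          have h1 : M.IsBase (insert v (B \ {u})) := Exch.isBase ⟨hu, hv, hj⟩ hB
          exact h1.exchange_isBase_of_indep hb hi
        have hsub : I ⊆ M.closure (B \ {a}) := by
          rintro x (rfl | ⟨rfl | hx, hxa⟩)
          · exact hab
          · exact hvcl
          · exact M.subset_closure (B \ {a}) (Set.sdiff_subset.trans hB.subset_ground)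
              ⟨hx.1, hxa⟩
        have := hBase.closure_eq ▸ M.closure_subset_closure_of_subset_closure hsub
        exact (hB.indep.notMem_closure_sdiff_of_mem haB.1) (this (hB.subset_ground haB.1))
      · have hbu' : b ∈ M.closure (B \ {u}) := by
          by_contra hbcl
          exact hc.2 ((exch_iff_notMem_closure hB hu hbB hbE).2 hbcl)
        have hcap : b ∈ M.closure ((B \ {a}) ∩ (B \ {u})) := by
          rw [Indep.closure_inter_eq_inter_closure
            (hB.indep.subset (Set.union_subset Set.sdiff_subset Set.sdiff_subset))]
          exact ⟨hab, hbu'⟩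
        refine hbcl (M.closure_subset_closure ?_ hcap)
        exact fun x hx => ⟨Set.mem_insert_of_mem _ hx.2, hx.1.2⟩

/-- An exchange along `u → v` does not destroy an arc `a → b`, provided that `a → v` is not an
arc. -/
theorem Exch.exch_insert_of_not_exch (hB : M.IsBase B) (h : M.Exch B u v) (h' : M.Exch B a b)
    (hau : a ≠ u) (hbv : b ≠ v) (hav : ¬ M.Exch B a v) :
    M.Exch (insert v (B \ {u})) a b := by
  have hbE := h'.mem_ground
  have hbcl := (exch_iff_notMem_closure hB h'.1 h'.2.1 hbE).1 h'
  rw [exch_iff_notMem_closure hB h'.1 h.2.1 h.mem_ground, not_not] at hav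
  have ha' : a ∈ insert v (B \ {u}) := Set.mem_insert_of_mem _ ⟨h'.1, hau⟩
  have hb' : b ∉ insert v (B \ {u}) := by
    rintro (rfl | hb)
    · exact hbv rfl
    · exact h'.2.1 hb.1
  rw [exch_iff_notMem_closure (h.isBase hB) ha' hb' hbE]
  refine fun hb => hbcl (M.closure_subset_closure_of_subset_closure ?_ hb)
  rintro x ⟨rfl | hx, hxa⟩
  · exact hav
  · exact M.subset_closure (B \ {a}) (Set.sdiff_subset.trans hB.subset_ground) ⟨hx.1, hxa⟩

/-- A set that no arc of the base `B` leaves is met by `B` in as few elements as possible: the part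
of `B` outside the set spans the complement of the set. -/
theorem IsBase.encard_sdiff_le_of_closed {B' R : Set α} (hB : M.IsBase B) (hB' : M.IsBase B')
    (hR : ∀ u v, u ∈ R → M.Exch B u v → v ∈ R) : (B' \ R).encard ≤ (B \ R).encard := by
  have hsub : B' \ R ⊆ M.closure (B \ R) := by
    intro v hv
    have hvE := hB'.subset_ground hv.1
    by_cases hvB : v ∈ B
    · exact M.subset_closure (B \ R) (Set.sdiff_subset.trans hB.subset_ground) ⟨hvB, hv.2⟩
    have hcl : v ∈ M.closure B := hB.closure_eq ▸ hvE
    have hC := hB.indep.fundCircuit_isCircuit hcl hvB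
    refine M.closure_subset_closure ?_
      (hC.mem_closure_sdiff_singleton_of_mem (M.mem_fundCircuit v B))
    rintro x ⟨hx, hxv⟩
    have hxB : x ∈ B := (M.fundCircuit_subset_insert v B hx).resolve_left hxv
    refine ⟨hxB, fun hxR => hv.2 (hR x v hxR ⟨hxB, hvB, ?_⟩)⟩
    rw [hB.indep.mem_fundCircuit_iff hcl hvB] at hx
    rwa [Set.insert_sdiff_singleton_comm (Ne.symm hxv)]
  calc (B' \ R).encard ≤ M.eRk (M.closure (B \ R)) :=
        (hB'.indep.subset Set.sdiff_subset).encard_le_eRk_of_subset hsub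
    _ = M.eRk (B \ R) := M.eRk_closure_eq _
    _ ≤ _ := M.eRk_le_encard _

end Matroid

/-! ### Multiplicities and optimality -/

section Multiplicity

open Classical in
/-- The number of members of the family `S 0, …, S (r - 1)` that contain `v`. -/
noncomputable def mult {α : Type*} (S : ℕ → Set α) (r : ℕ) (v : α) : ℕ :=
  ((Finset.range r).filter (fun i => v ∈ S i)).card

variable {α : Type*} {M : Matroid α} {S T : ℕ → Set α} {r : ℕ} {V : Finset α}

theorem mult_le (S : ℕ → Set α) (r : ℕ) (v : α) : mult S r v ≤ r := by
  classical
  simpa [mult] using Finset.card_filter_le (Finset.range r) (fun i => v ∈ S i)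

theorem mult_succ (S : ℕ → Set α) (i : ℕ) (v : α) [Decidable (v ∈ S i)] :
    mult S (i + 1) v = mult S i v + if v ∈ S i then 1 else 0 := by
  classical
  simp only [mult, Finset.card_filter, Finset.sum_range_succ]
  congr

theorem sum_mult (S : ℕ → Set α) (r : ℕ) (R : Finset α) :
    ∑ v ∈ R, mult S r v = ∑ i ∈ Finset.range r, (S i ∩ R).ncard := by
  classical
  have h : ∀ i, (S i ∩ R).ncard = (R.filter (fun v => v ∈ S i)).card := by
    intro i
    rw [← Set.ncard_coe_finset]
    congr 1
    ext v
    simp [and_comm]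
  simp only [mult, h, Finset.card_filter]
  rw [Finset.sum_comm]

theorem sum_mult_le_of_closed (hV : M.E = V) (hS : ∀ i < r, M.IsBase (S i))
    (hT : ∀ i < r, M.IsBase (T i)) (R : Finset α)
    (hR : ∀ i < r, ∀ u v, u ∈ R → M.Exch (S i) u v → v ∈ R) :
    ∑ v ∈ R, mult S r v ≤ ∑ v ∈ R, mult T r v := by
  rw [sum_mult, sum_mult]
  refine Finset.sum_le_sum fun i hi => ?_
  rw [Finset.mem_range] at hi
  have hfin : ∀ {B}, M.IsBase B → B.Finite := fun hB =>
    V.finite_toSet.subset (hV ▸ hB.subset_ground)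
  have h1 := (hS i hi).encard_sdiff_le_of_closed (hT i hi) (R := R) (hR i hi)
  have f1 := hfin (hS i hi)
  have f2 := hfin (hT i hi)
  rw [← (f1.subset Set.sdiff_subset).cast_ncard_eq, ← (f2.subset Set.sdiff_subset).cast_ncard_eq,
    Nat.cast_le] at h1
  have h2 := (hS i hi).ncard_eq_ncard_of_isBase (hT i hi)
  have h3 := Set.ncard_inter_add_ncard_sdiff_eq_ncard (S i) R f1
  have h4 := Set.ncard_inter_add_ncard_sdiff_eq_ncard (T i) R f2
  omega

theorem sum_mult_ground (hV : M.E = V) (hS : ∀ i < r, M.IsBase (S i))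
    (hT : ∀ i < r, M.IsBase (T i)) :
    ∑ v ∈ V, mult S r v = ∑ v ∈ V, mult T r v := by
  apply le_antisymm
  · exact sum_mult_le_of_closed hV hS hT V fun i _ u v _ h => by
      have := h.mem_ground; rwa [hV] at this
  · exact sum_mult_le_of_closed hV hT hS V fun i _ u v _ h => by
      have := h.mem_ground; rwa [hV] at this

/-- Level `k` is balanced if some set that no exchange arc leaves contains all elements of
multiplicity at least `k` and only elements of multiplicity at least `k - 1`. -/
def LevelBalanced (M : Matroid α) (S : ℕ → Set α) (r k : ℕ) : Prop :=
  ∃ R : Set α, (∀ v ∈ M.E, k ≤ mult S r v → v ∈ R) ∧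
    (∀ v ∈ M.E, v ∈ R → k ≤ mult S r v + 1) ∧
    ∀ i < r, ∀ u v, u ∈ R → M.Exch (S i) u v → v ∈ R

/-- If every level is balanced then the family minimizes the sum of the squares of the
multiplicities: counting the certificates that contain `v` gives a subgradient of the square
function at `mult S r v`, and the certificates are met by `S` as rarely as possible. -/
theorem sum_mult_sq_le_of_balanced (hV : M.E = V) (hS : ∀ i < r, M.IsBase (S i))
    (hT : ∀ i < r, M.IsBase (T i)) (hbal : ∀ k, 1 ≤ k → k ≤ r → LevelBalanced M S r k) :
    ∑ v ∈ V, mult S r v ^ 2 ≤ ∑ v ∈ V, mult T r v ^ 2 := by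
  classical
  have hVE : ∀ v, v ∈ V ↔ v ∈ M.E := fun v => by simp [hV]
  choose! R hR1 hR2 hR3 using hbal
  set g : α → ℕ := fun v => ((Finset.Icc 1 r).filter (fun k => v ∈ R k)).card with hg
  have hglow : ∀ v ∈ V, mult S r v ≤ g v := by
    intro v hv
    have : Finset.Icc 1 (mult S r v) ⊆ (Finset.Icc 1 r).filter (fun k => v ∈ R k) := by
      intro k hk
      rw [Finset.mem_Icc] at hk
      have hkr := hk.2.trans (mult_le S r v)
      exact Finset.mem_filter.2 ⟨Finset.mem_Icc.2 ⟨hk.1, hkr⟩,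
        hR1 k hk.1 hkr v ((hVE v).1 hv) hk.2⟩
    simpa using Finset.card_le_card this
  have hgup : ∀ v ∈ V, g v ≤ mult S r v + 1 := by
    intro v hv
    have : (Finset.Icc 1 r).filter (fun k => v ∈ R k) ⊆ Finset.Icc 1 (mult S r v + 1) := by
      intro k hk
      rw [Finset.mem_filter, Finset.mem_Icc] at hk
      exact Finset.mem_Icc.2 ⟨hk.1.1, hR2 k hk.1.1 hk.1.2 v ((hVE v).1 hv) hk.2⟩
    simpa using Finset.card_le_card this
  have hpt : ∀ v ∈ V, (mult S r v : ℤ) ^ 2 +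
      (2 * (g v : ℤ) - 1) * ((mult T r v : ℤ) - mult S r v) ≤ (mult T r v : ℤ) ^ 2 := by
    intro v hv
    have h1 := hglow v hv
    have h2 := hgup v hv
    set s := mult S r v
    set t := mult T r v
    have hcase : g v = s ∨ g v = s + 1 := by omega
    have key : ∀ d : ℤ, 0 ≤ d * (d - 1) := by
      intro d
      rcases le_or_gt d 0 with hd | hd
      · exact mul_nonneg_of_nonpos_of_nonpos hd (by omega)
      · exact mul_nonneg (by omega) (by omega)
    rcases hcase with h | h
    · have := key ((s : ℤ) - t)
      rw [h]; nlinarith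
    · have := key ((t : ℤ) - s)
      rw [h]; push_cast; nlinarith
  have hsum : ∑ v ∈ V, (g v : ℤ) * ((mult T r v : ℤ) - mult S r v) =
      ∑ k ∈ Finset.Icc 1 r, ∑ v ∈ V.filter (fun v => v ∈ R k),
        ((mult T r v : ℤ) - mult S r v) := by
    simp only [hg, Finset.card_filter, Nat.cast_sum, Finset.sum_mul, Finset.sum_filter]
    rw [Finset.sum_comm]
    refine Finset.sum_congr rfl fun k _ => Finset.sum_congr rfl fun v _ => ?_
    split_ifs <;> simp
  have hnonneg : 0 ≤ ∑ v ∈ V, (g v : ℤ) * ((mult T r v : ℤ) - mult S r v) := by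
    rw [hsum]
    refine Finset.sum_nonneg fun k hk => ?_
    rw [Finset.mem_Icc] at hk
    have := sum_mult_le_of_closed hV hS hT (V.filter (fun v => v ∈ R k)) (by
      intro i hi u v hu huv
      rw [Finset.mem_filter] at hu ⊢
      exact ⟨(hVE v).2 huv.mem_ground, hR3 k hk.1 hk.2 i hi u v hu.2 huv⟩)
    rw [Finset.sum_sub_distrib]
    have h2 : (∑ v ∈ V.filter (fun v => v ∈ R k), (mult S r v : ℤ)) ≤
      ∑ v ∈ V.filter (fun v => v ∈ R k), (mult T r v : ℤ) := by exact_mod_cast this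
    omega
  have htot : ∑ v ∈ V, ((mult T r v : ℤ) - mult S r v) = 0 := by
    have := sum_mult_ground hV hS hT
    have h2 : (∑ v ∈ V, (mult S r v : ℤ)) = ∑ v ∈ V, (mult T r v : ℤ) := by exact_mod_cast this
    rw [Finset.sum_sub_distrib, h2, sub_self]
  have hfin := Finset.sum_le_sum hpt
  rw [Finset.sum_add_distrib] at hfin
  have hexp : ∑ v ∈ V, (2 * (g v : ℤ) - 1) * ((mult T r v : ℤ) - mult S r v) =
      2 * ∑ v ∈ V, (g v : ℤ) * ((mult T r v : ℤ) - mult S r v) -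
        ∑ v ∈ V, ((mult T r v : ℤ) - mult S r v) := by
    rw [Finset.mul_sum, ← Finset.sum_sub_distrib]
    exact Finset.sum_congr rfl fun v _ => by ring
  rw [hexp, htot] at hfin
  have : (∑ v ∈ V, (mult S r v : ℤ) ^ 2) ≤ ∑ v ∈ V, (mult T r v : ℤ) ^ 2 := by linarith
  exact_mod_cast this

end Multiplicity

/-! ### Diversity in terms of multiplicities -/

section Diversity

variable {α : Type*} {M : Matroid α} {r : ℕ} {V : Finset α}

/-- Pairing the terms for `(i, j)` and `(j, i)` turns a sum over pairs `i < j` into a sum over all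
ordered pairs. -/
theorem sum_Ioi_add_swap {r : ℕ} (f : Fin r → Fin r → ℕ) (hf : ∀ i, f i i = 0) :
    ∑ i, ∑ j ∈ Finset.Ioi i, (f i j + f j i) = ∑ i, ∑ j, f i j := by
  have h1 : ∀ i : Fin r, ∑ j, f i j =
      ∑ j, (if i < j then f i j else 0) + ∑ j, (if j < i then f i j else 0) := by
    intro i
    rw [← Finset.sum_add_distrib]
    refine Finset.sum_congr rfl fun j _ => ?_
    rcases lt_trichotomy i j with h | h | h
    · simp [h, h.not_gt]
    · subst h; simp [hf]
    · simp [h, h.not_gt]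
  have h2 : ∀ i : Fin r, Finset.Ioi i = Finset.univ.filter (fun j => i < j) := by
    intro i; ext j; simp
  simp only [h1, h2, Finset.sum_add_distrib, Finset.sum_filter]
  congr 1
  rw [Finset.sum_comm]

/-- The diversity of a family of subsets of `V` in terms of multiplicities. -/
theorem dSum_eq (S : ℕ → Set α) (hS : ∀ i < r, S i ⊆ V) :
    dSum (fun i : Fin r => S i) = ∑ v ∈ V, mult S r v * (r - mult S r v) := by
  classical
  have h : ∀ i j : Fin r, (S i \ S j).ncard =
      ∑ v ∈ V, (if v ∈ S i then 1 else 0) * (if v ∉ S j then 1 else 0) := by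
    intro i j
    have : S i \ S j = (V.filter (fun v => v ∈ S i ∧ v ∉ S j) : Finset α) := by
      ext v
      simp only [Set.mem_sdiff, Finset.coe_filter, Set.mem_ofPred_eq]
      exact ⟨fun h => ⟨hS i i.2 h.1, h⟩, fun h => h.2⟩
    rw [this, Set.ncard_coe_finset, Finset.card_filter]
    refine Finset.sum_congr rfl fun v _ => ?_
    by_cases h1 : v ∈ S i <;> by_cases h2 : v ∈ S j <;> simp [h1, h2]
  have hm : ∀ v, ∑ i : Fin r, (if v ∈ S i then 1 else 0) = mult S r v := by
    intro v
    rw [mult, Finset.card_filter, Finset.sum_range]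
  have hm' : ∀ v, ∑ i : Fin r, (if v ∉ S i then 1 else 0) = r - mult S r v := by
    intro v
    have h2 : ∑ i : Fin r, (if v ∈ S i then 1 else 0) + ∑ i : Fin r, (if v ∉ S i then 1 else 0)
        = r := by
      rw [← Finset.sum_add_distrib]
      have : ∀ i : Fin r, ((if v ∈ S i then 1 else 0) + (if v ∉ S i then 1 else 0)) = 1 := by
        intro i; by_cases h1 : v ∈ S i <;> simp [h1]
      rw [Finset.sum_congr rfl fun i _ => this i]; simp
    rw [hm] at h2
    omega
  rw [dSum, sum_Ioi_add_swap (fun i j => (S i \ S j).ncard) (by simp)]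
  simp only [h]
  have hstep : ∀ i : Fin r, ∑ j : Fin r, ∑ v ∈ V,
      (if v ∈ S i then 1 else 0) * (if v ∉ S j then 1 else 0) =
      ∑ v ∈ V, (if v ∈ S i then 1 else 0) * (r - mult S r v) := by
    intro i
    rw [Finset.sum_comm]
    refine Finset.sum_congr rfl fun v _ => ?_
    rw [← Finset.mul_sum, hm']
  simp only [hstep]
  rw [Finset.sum_comm]
  refine Finset.sum_congr rfl fun v _ => ?_
  rw [← Finset.sum_mul, hm]

/-- Among families of bases, a smaller sum of squared multiplicities means a larger diversity. -/
theorem dSum_le_of_sum_mult_sq_le {S T : ℕ → Set α} (hV : M.E = V)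
    (hS : ∀ i < r, M.IsBase (S i)) (hT : ∀ i < r, M.IsBase (T i))
    (h : ∑ v ∈ V, mult S r v ^ 2 ≤ ∑ v ∈ V, mult T r v ^ 2) :
    dSum (fun i : Fin r => T i) ≤ dSum (fun i : Fin r => S i) := by
  rw [dSum_eq S fun i hi => hV ▸ (hS i hi).subset_ground,
    dSum_eq T fun i hi => hV ▸ (hT i hi).subset_ground]
  have key : ∀ S : ℕ → Set α, ∑ v ∈ V, mult S r v * (r - mult S r v) + ∑ v ∈ V, mult S r v ^ 2 =
      (∑ v ∈ V, mult S r v) * r := by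
    intro S
    rw [← Finset.sum_add_distrib, Finset.sum_mul]
    refine Finset.sum_congr rfl fun v _ => ?_
    rw [sq, ← mul_add, Nat.sub_add_cancel (mult_le S r v)]
  have h1 := key S
  have h2 := key T
  rw [sum_mult_ground hV hS hT] at h1
  omega

end Diversity

/-! ### Programs with bounded loops -/

namespace OracleProgram

@[simp] theorem State.reg_setReg (s : State) (x v : ℕ) :
    (s.setReg x v).reg = Function.update s.reg x v := rfl

@[simp] theorem State.arr_setReg (s : State) (x v : ℕ) : (s.setReg x v).arr = s.arr := rfl

@[simp] theorem State.reg_setCell (s : State) (k a v : ℕ) : (s.setCell k a v).reg = s.reg := rfl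

@[simp] theorem State.arr_setCell (s : State) (k a v : ℕ) :
    (s.setCell k a v).arr = Function.update s.arr k (Function.update (s.arr k) a v) := rfl

/-- Programs whose only loops are counting loops: `forto x b c` runs `c` with register `x` equal to
`0, …, m - 1`, where `m` is the content of register `b`. -/
inductive Code where
  | skip
  | assign (x : ℕ) (a : Expr)
  | store (k : ℕ) (i a : Expr)
  | query (x k : ℕ)
  | seq (p q : Code)
  | cond (b : Expr) (p q : Code)
  | forto (x b : ℕ) (p : Code)

namespace Code

/-- The translation into oracle programs. -/
def toProgram : Code → Program
  | skip => .skip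
  | assign x a => .assign x a
  | store k i a => .store k i a
  | query x k => .query x k
  | seq p q => .seq p.toProgram q.toProgram
  | cond b p q => .cond b p.toProgram q.toProgram
  | forto x b p => .seq (.assign x (.const 0)) (.loop (.sub (.reg b) (.reg x))
      (.seq p.toProgram (.assign x (.add (.reg x) (.const 1)))))

open Classical in
/-- The state in which a piece of code halts. -/
noncomputable def run (ask : (ℕ → ℕ) → Prop) : Code → State → State
  | skip, s => s
  | assign x a, s => s.setReg x (a.eval s)
  | store k i a, s => s.setCell k (i.eval s) (a.eval s)
  | query x k, s => s.setReg x (if ask (s.arr k) then 1 else 0)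
  | seq p q, s => q.run ask (p.run ask s)
  | cond b p q, s => if b.eval s ≠ 0 then p.run ask s else q.run ask s
  | forto x b p, s =>
      Nat.rec (s.setReg x 0) (fun j s' => (p.run ask s').setReg x (j + 1)) (s.reg b)

/-- A bound for the running time, as a polynomial in a common bound for the contents of registers
`0` and `1` and the time that the oracle takes. -/
noncomputable def time : Code → Polynomial ℕ
  | skip => 1
  | assign _ a => .C (1 + a.cost)
  | store _ i a => .C (1 + i.cost + a.cost)
  | query _ _ => 1 + .X
  | seq p q => p.time + q.time
  | cond b p q => .C (1 + b.cost) + p.time + q.time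
  | forto _ _ p => .X * (p.time + 8) + 6

/-- Does the code possibly write register `y`? -/
def writesReg : Code → ℕ → Bool
  | skip, _ => false
  | assign x _, y => x == y
  | store _ _ _, _ => false
  | query x _, y => x == y
  | seq p q, y => p.writesReg y || q.writesReg y
  | cond _ p q, y => p.writesReg y || q.writesReg y
  | forto x _ p, y => x == y || p.writesReg y

/-- Does the code possibly write array `k`? -/
def writesArr : Code → ℕ → Bool
  | skip, _ => false
  | assign _ _, _ => false
  | store k' _ _, k => k' == k
  | query _ _, _ => false
  | seq p q, k => p.writesArr k || q.writesArr k
  | cond _ p q, k => p.writesArr k || q.writesArr k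
  | forto _ _ p, k => p.writesArr k

/-- The code leaves the input registers `0` and `1` alone, and its loops count in a register that
their bodies do not write up to the content of an input register. -/
def WF : Code → Bool
  | skip => true
  | assign x _ => 2 ≤ x
  | store _ _ _ => true
  | query x _ => 2 ≤ x
  | seq p q => p.WF && q.WF
  | cond _ p q => p.WF && q.WF
  | forto x b p => 2 ≤ x && b < 2 && p.WF && !p.writesReg x

variable {ask : (ℕ → ℕ) → Prop}

@[simp] theorem run_skip (s : State) : skip.run ask s = s := rfl

@[simp] theorem run_assign (x : ℕ) (a : Expr) (s : State) :
    (assign x a).run ask s = s.setReg x (a.eval s) := rfl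

@[simp] theorem run_store (k : ℕ) (i a : Expr) (s : State) :
    (store k i a).run ask s = s.setCell k (i.eval s) (a.eval s) := rfl

@[simp] theorem run_seq (p q : Code) (s : State) :
    (seq p q).run ask s = q.run ask (p.run ask s) := rfl

open Classical in
@[simp] theorem run_query (x k : ℕ) (s : State) :
    (query x k).run ask s = s.setReg x (if ask (s.arr k) then 1 else 0) := by
  simp only [run]

theorem run_query_reg_ne_zero (x k : ℕ) (s : State) :
    ((query x k).run ask s).reg x ≠ 0 ↔ ask (s.arr k) := by
  classical
  rw [run_query, State.reg_setReg, Function.update_self]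
  split_ifs with h <;> simp [h]

@[simp] theorem run_cond (b : Expr) (p q : Code) (s : State) :
    (cond b p q).run ask s = if b.eval s ≠ 0 then p.run ask s else q.run ask s := by
  simp only [run]

theorem run_cond_of_ne_zero {b : Expr} {s : State} (h : b.eval s ≠ 0) (p q : Code) :
    (cond b p q).run ask s = p.run ask s := by
  rw [run_cond, if_pos h]

theorem run_cond_of_eq_zero {b : Expr} {s : State} (h : b.eval s = 0) (p q : Code) :
    (cond b p q).run ask s = q.run ask s := by
  rw [run_cond, if_neg (not_not.2 h)]

theorem run_reg_of_writesReg {c : Code} {y : ℕ} (h : c.writesReg y = false) (s : State) :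
    (c.run ask s).reg y = s.reg y := by
  induction c generalizing s with
  | skip => rfl
  | assign x a =>
    have : y ≠ x := by rintro rfl; simp [writesReg] at h
    simp [run, this]
  | store k i a => rfl
  | query x k =>
    have : y ≠ x := by rintro rfl; simp [writesReg] at h
    simp [run, this]
  | seq p q hp hq =>
    simp only [writesReg, Bool.or_eq_false_iff] at h
    simp only [run]
    rw [hq h.2, hp h.1]
  | cond b p q hp hq =>
    simp only [writesReg, Bool.or_eq_false_iff] at h
    simp only [run]
    split_ifs
    · exact hp h.1 s
    · exact hq h.2 s
  | forto x b p hp =>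
    simp only [writesReg, Bool.or_eq_false_iff] at h
    have hx : y ≠ x := by rintro rfl; simp at h
    simp only [run]
    generalize s.reg b = m
    induction m with
    | zero => simp [hx]
    | succ m ih => simp [hx, hp h.2, ih]

theorem run_arr_of_writesArr {c : Code} {k : ℕ} (h : c.writesArr k = false) (s : State) :
    (c.run ask s).arr k = s.arr k := by
  induction c generalizing s with
  | skip => rfl
  | assign x a => rfl
  | store k' i a =>
    have : k ≠ k' := by rintro rfl; simp [writesArr] at h
    simp [run, this]
  | query x k => rfl
  | seq p q hp hq =>
    simp only [writesArr, Bool.or_eq_false_iff] at h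
    simp only [run]
    rw [hq h.2, hp h.1]
  | cond b p q hp hq =>
    simp only [writesArr, Bool.or_eq_false_iff] at h
    simp only [run]
    split_ifs
    · exact hp h.1 s
    · exact hq h.2 s
  | forto x b p hp =>
    simp only [writesArr] at h
    simp only [run]
    generalize s.reg b = m
    induction m with
    | zero => simp
    | succ m ih => simp [hp h, ih]

theorem WF.writesReg_eq_false {c : Code} (h : c.WF) {y : ℕ} (hy : y < 2) :
    c.writesReg y = false := by
  induction c with
  | skip => rfl
  | assign x a => simp [WF] at h; simp [writesReg]; omega
  | store k i a => rfl
  | query x k => simp [WF] at h; simp [writesReg]; omega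
  | seq p q hp hq =>
    simp only [WF, Bool.and_eq_true] at h
    simp [writesReg, hp h.1, hq h.2]
  | cond b p q hp hq =>
    simp only [WF, Bool.and_eq_true] at h
    simp [writesReg, hp h.1, hq h.2]
  | forto x b p hp =>
    simp only [WF, Bool.and_eq_true, decide_eq_true_eq] at h
    simp only [writesReg, hp h.1.2, Bool.or_false, beq_eq_false_iff_ne]
    omega

/-- Well-formed code halts in the state given by `run`, within the time given by `time`. -/
theorem exists_exec {c : Code} (h : c.WF) {s : State} {N Q : ℕ} (h0 : s.reg 0 ≤ N)
    (h1 : s.reg 1 ≤ N) (hQ : Q ≤ N) :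
    ∃ t ≤ c.time.eval N, Exec ask Q c.toProgram s (c.run ask s) t := by
  induction c generalizing s with
  | skip => exact ⟨1, by simp [time], .skip s⟩
  | assign x a => exact ⟨_, by simp [time], .assign s x a⟩
  | store k i a => exact ⟨_, by simp [time], .store s k i a⟩
  | query x k =>
    refine ⟨1 + Q, by simpa [time] using hQ, ?_⟩
    by_cases hk : ask (s.arr k)
    · simpa [run, toProgram, hk] using Exec.queryYes (Q := Q) s x k hk
    · simpa [run, toProgram, hk] using Exec.queryNo (Q := Q) s x k hk
  | seq p q hp hq =>
    simp only [WF, Bool.and_eq_true] at h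
    obtain ⟨t₁, ht₁, e₁⟩ := hp h.1 h0 h1
    obtain ⟨t₂, ht₂, e₂⟩ := hq h.2 (s := p.run ask s)
      (by rwa [run_reg_of_writesReg (WF.writesReg_eq_false h.1 (by norm_num))])
      (by rwa [run_reg_of_writesReg (WF.writesReg_eq_false h.1 (by norm_num))])
    exact ⟨_, by simpa [time] using add_le_add ht₁ ht₂, .seq e₁ e₂⟩
  | cond b p q hp hq =>
    simp only [WF, Bool.and_eq_true] at h
    by_cases hb : b.eval s = 0
    · obtain ⟨t, ht, e⟩ := hq h.2 h0 h1
      refine ⟨1 + b.cost + t, ?_, ?_⟩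
      · simp only [time, Polynomial.eval_add, Polynomial.eval_C]; omega
      · simpa [run, toProgram, hb] using Exec.condFalse hb e
    · obtain ⟨t, ht, e⟩ := hp h.1 h0 h1
      refine ⟨1 + b.cost + t, ?_, ?_⟩
      · simp only [time, Polynomial.eval_add, Polynomial.eval_C]; omega
      · simpa [run, toProgram, hb] using Exec.condTrue hb e
  | forto x b p hp =>
    simp only [WF, Bool.and_eq_true, decide_eq_true_eq, Bool.not_eq_true'] at h
    obtain ⟨⟨⟨hx, hb⟩, hwf⟩, hpx⟩ := h
    have hbx : b ≠ x := by omega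
    have hbN : s.reg b ≤ N := by interval_cases b <;> assumption
    set F : ℕ → State := fun m =>
      Nat.rec (s.setReg x 0) (fun j s' => (p.run ask s').setReg x (j + 1)) m with hF
    have hFx : ∀ m, (F m).reg x = m := by
      intro m; cases m <;> simp [hF]
    have hFy : ∀ m, ∀ y < 2, (F m).reg y = s.reg y := by
      intro m y hy
      have hyx : y ≠ x := by omega
      induction m with
      | zero => simp [hF, hyx]
      | succ m ih =>
        simp only [hF, State.reg_setReg, Function.update_of_ne hyx] at ih ⊢
        rw [run_reg_of_writesReg (WF.writesReg_eq_false hwf hy), ih]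
    -- The loop, started in the `j`-th intermediate state, still has `s.reg b - j` rounds to go.
    have hloop : ∀ d j, j + d = s.reg b → ∃ t ≤ d * (p.time.eval N + 8) + 4,
        Exec ask Q (.loop (.sub (.reg b) (.reg x))
          (.seq p.toProgram (.assign x (.add (.reg x) (.const 1))))) (F j) (F (s.reg b)) t := by
      intro d
      induction d with
      | zero =>
        intro j hj
        obtain rfl : j = s.reg b := by omega
        refine ⟨_, ?_, .loopFalse ?_⟩
        · simp [Expr.cost]
        · simp [Expr.eval, hFx, hFy _ b hb]
      | succ d ih =>
        intro j hj
        obtain ⟨t₂, ht₂, e₂⟩ := ih (j + 1) (by omega)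
        obtain ⟨t₁, ht₁, e₁⟩ := hp hwf (s := F j) (by rwa [hFy _ 0 (by norm_num)])
          (by rwa [hFy _ 1 (by norm_num)])
        have e := Exec.seq e₁
          (Exec.assign (ask := ask) (Q := Q) (p.run ask (F j)) x (.add (.reg x) (.const 1)))
        have hstep : (p.run ask (F j)).setReg x
            (Expr.eval (p.run ask (F j)) (.add (.reg x) (.const 1))) = F (j + 1) := by
          simp only [Expr.eval, run_reg_of_writesReg hpx, hFx]
          rfl
        rw [hstep] at e
        refine ⟨_, ?_, .loopTrue ?_ e e₂⟩
        · simp only [Expr.cost]; nlinarith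
        · simp only [Expr.eval, hFx, hFy _ b hb]; omega
    obtain ⟨t, ht, e⟩ := hloop (s.reg b) 0 (by omega)
    refine ⟨_, ?_, .seq (.assign s x (.const 0)) e⟩
    simp only [time, Polynomial.eval_add, Polynomial.eval_mul, Polynomial.eval_X,
      Polynomial.eval_ofNat, Expr.cost]
    have := Nat.mul_le_mul_right (p.time.eval N + 8) hbN
    omega

/-- The invariant rule for counting loops. -/
theorem run_forto_induction {x b : ℕ} {p : Code} {s : State} (I : ℕ → State → Prop)
    (hpx : p.writesReg x = false) (h0 : I 0 (s.setReg x 0))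
    (hstep : ∀ j < s.reg b, ∀ s', s'.reg x = j →
      (∀ y, (forto x b p).writesReg y = false → s'.reg y = s.reg y) →
      (∀ k, p.writesArr k = false → s'.arr k = s.arr k) →
      I j s' → I (j + 1) ((p.run ask s').setReg x (j + 1))) :
    I (s.reg b) ((forto x b p).run ask s) := by
  simp only [run]
  have key : ∀ m ≤ s.reg b, ∀ s', s' =
      Nat.rec (s.setReg x 0) (fun j s' => (p.run ask s').setReg x (j + 1)) m →
      I m s' ∧ s'.reg x = m ∧ (∀ y, (forto x b p).writesReg y = false → s'.reg y = s.reg y) ∧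
      (∀ k, p.writesArr k = false → s'.arr k = s.arr k) := by
    intro m
    induction m with
    | zero =>
      rintro _ s' rfl
      refine ⟨h0, by simp, fun y hy => ?_, fun k _ => rfl⟩
      have : y ≠ x := by rintro rfl; simp [writesReg] at hy
      simp [this]
    | succ m ih =>
      rintro hm s' rfl
      obtain ⟨h1, h2, h3, h4⟩ := ih (by omega) _ rfl
      refine ⟨hstep m (by omega) _ h2 h3 h4 h1, by simp, fun y hy => ?_, fun k hk => ?_⟩
      · have hyx : y ≠ x := by rintro rfl; simp [writesReg] at hy
        have hy' := hy
        simp only [writesReg, Bool.or_eq_false_iff] at hy'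
        simp only [State.reg_setReg, Function.update_of_ne hyx]
        rw [run_reg_of_writesReg hy'.2, h3 y hy]
      · simp only [State.arr_setReg]
        rw [run_arr_of_writesArr hk, h4 k hk]
  exact (key _ le_rfl _ rfl).1

end Code

end OracleProgram

/-! ### Distance labels -/

section Labels

variable {α : Type*} {M : Matroid α} {S : ℕ → Set α} {r : ℕ} {D : α → ℕ}

/-- Along an exchange arc of a member of the family the label grows by at most one. -/
def ValidLabel (M : Matroid α) (S : ℕ → Set α) (r : ℕ) (D : α → ℕ) : Prop :=
  ∀ i < r, ∀ u v, M.Exch (S i) u v → D v ≤ D u + 1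

/-- Every element with a positive label that is at most `m` is the head of an exchange arc along
which the label grows by exactly one. -/
def TightBelow (M : Matroid α) (S : ℕ → Set α) (r : ℕ) (D : α → ℕ) (m : ℕ) : Prop :=
  ∀ v ∈ M.E, 0 < D v → D v ≤ m → ∃ i < r, ∃ u, M.Exch (S i) u v ∧ D u + 1 = D v

/-- The family `S` with `u` exchanged for `v` in the `i`-th member. -/
def swapFamily (S : ℕ → Set α) (i : ℕ) (u v : α) : ℕ → Set α :=
  Function.update S i (insert v (S i \ {u}))

theorem isBase_swapFamily {i : ℕ} {u v : α} (hS : ∀ i < r, M.IsBase (S i))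
    (h : M.Exch (S i) u v) : ∀ j < r, M.IsBase (swapFamily S i u v j) := by
  intro j hj
  rcases eq_or_ne j i with rfl | hji
  · simpa [swapFamily] using h.isBase (hS j hj)
  · simpa [swapFamily, hji] using hS j hj

theorem ValidLabel.swapFamily {i : ℕ} (hi : i < r) {u v : α} (hS : ∀ i < r, M.IsBase (S i))
    (hD : ValidLabel M S r D) (h : M.Exch (S i) u v) (huv : D u + 1 = D v) :
    ValidLabel M (swapFamily S i u v) r D := by
  intro j hj a b hab
  rcases eq_or_ne j i with rfl | hji
  · simp only [_root_.swapFamily, Function.update_self] at hab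
    rcases h.exch_of_exch_insert (hS j hj) hab with hab | ⟨ha, hb⟩
    · exact hD j hj a b hab
    · have h1 : D v ≤ D a + 1 := by
        rcases ha with rfl | ha
        · omega
        · exact hD j hj _ _ ha
      have h2 : D b ≤ D u + 1 := by
        rcases hb with rfl | hb
        · omega
        · exact hD j hj _ _ hb
      omega
  · simp only [_root_.swapFamily, Function.update_of_ne hji] at hab
    exact hD j hj a b hab

/-- Exchanging along a tight arc `u → v` preserves the tight arcs that end at labels up to `D u`:
an arc `a → v` from the tail of such an arc would violate validity. -/
theorem TightBelow.swapFamily {i m : ℕ} {u v : α} (hS : ∀ i < r, M.IsBase (S i))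
    (hD : ValidLabel M S r D) (hT : TightBelow M S r D m) (hm : D v ≤ m)
    (h : M.Exch (S i) u v) (huv : D u + 1 = D v) :
    TightBelow M (swapFamily S i u v) r D (D u) := by
  intro b hb hb0 hbu
  obtain ⟨j, hj, a, hab, hDab⟩ := hT b hb hb0 (by omega)
  refine ⟨j, hj, a, ?_, hDab⟩
  rcases eq_or_ne j i with rfl | hji
  · simp only [_root_.swapFamily, Function.update_self]
    refine h.exch_insert_of_not_exch (hS j hj) hab ?_ ?_ ?_
    · rintro rfl; omega
    · rintro rfl; omega
    · intro hav
      have := hD j hj _ _ hav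
      omega
  · simpa only [_root_.swapFamily, Function.update_of_ne hji] using hab

open Classical in
theorem mult_swapFamily {i : ℕ} (hi : i < r) {u v : α} (h : M.Exch (S i) u v) (w : α) :
    mult (swapFamily S i u v) r w + (if w = u then 1 else 0) =
      mult S r w + (if w = v then 1 else 0) := by
  obtain ⟨hu, hv, -⟩ := h
  have hi' : i ∈ Finset.range r := Finset.mem_range.2 hi
  simp only [mult, Finset.card_filter]
  rw [← Finset.add_sum_erase _ _ hi', ← Finset.add_sum_erase _ _ hi']
  have : ∑ j ∈ (Finset.range r).erase i, (if w ∈ swapFamily S i u v j then 1 else 0) =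
      ∑ j ∈ (Finset.range r).erase i, (if w ∈ S j then 1 else 0) := by
    refine Finset.sum_congr rfl fun j hj => ?_
    simp [swapFamily, Function.update_of_ne (Finset.ne_of_mem_erase hj)]
  rw [this]
  simp only [swapFamily, Function.update_self, Set.mem_insert_iff, Set.mem_sdiff,
    Set.mem_singleton_iff]
  have huv : u ≠ v := fun e => hv (e ▸ hu)
  by_cases h1 : w = u
  · subst h1; simp [huv, hu]; omega
  · by_cases h2 : w = v
    · subst h2; simp [hv, h1]; omega
    · simp [h1, h2]

/-- What is true of a breadth-first labelling while it is being computed: the elements of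
multiplicity at least `k` have label `0`, the label `n + 1` means not reached, and the other labels
come from a tight arc. -/
structure BFSInv (M : Matroid α) (S : ℕ → Set α) (r n k : ℕ) (D : α → ℕ) : Prop where
  le : ∀ v ∈ M.E, D v ≤ n + 1
  zero : ∀ v ∈ M.E, D v = 0 ↔ k ≤ mult S r v
  tight : TightBelow M S r D n

/-- The arcs that leave level `l` lead to level `l + 1` or below. -/
def Settled (M : Matroid α) (S : ℕ → Set α) (r : ℕ) (D : α → ℕ) (l : ℕ) : Prop :=
  ∀ i < r, ∀ u v, M.Exch (S i) u v → D u = l → D v ≤ l + 1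

variable {n k : ℕ}

theorem BFSInv.update [DecidableEq α] {i l : ℕ} (hD : BFSInv M S r n k D) (hi : i < r) {u v : α}
    (h : M.Exch (S i) u v) (hl : l < n) (hu : D u = l) (hv : n + 1 ≤ D v) :
    BFSInv M S r n k (Function.update D v (l + 1)) := by
  have huv : u ≠ v := by rintro rfl; omega
  have hvE := h.mem_ground
  refine ⟨fun w hw => ?_, fun w hw => ?_, fun w hw h0 hn => ?_⟩
  · rcases eq_or_ne w v with rfl | hwv
    · simp; omega
    · simpa [hwv] using hD.le w hw
  · rcases eq_or_ne w v with rfl | hwv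
    · have := hD.zero w hw
      simp only [Function.update_self, Nat.add_eq_zero_iff, one_ne_zero, and_false, false_iff]
      intro hk
      have := this.2 hk
      omega
    · simpa [hwv] using hD.zero w hw
  · rcases eq_or_ne w v with rfl | hwv
    · exact ⟨i, hi, u, h, by simp [huv, hu]⟩
    · simp only [Function.update_of_ne hwv] at h0 hn ⊢
      obtain ⟨j, hj, a, ha, hDa⟩ := hD.tight w hw h0 hn
      have hav : a ≠ v := by rintro rfl; omega
      exact ⟨j, hj, a, ha, by simpa [hav] using hDa⟩

/-- Giving the label `l + 1` to an element `v` that was not reached before does not unsettle a pair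
`a`, `b` with respect to a level `l' ≤ l`: afterwards `v` is not on level `l'`, and if `b` was on
level `l' + 1` or below then `b ≠ v`. -/
theorem le_update_of_le [DecidableEq α] {l l' : ℕ} {v a b : α} (hl : l < n) (hl' : l' ≤ l)
    (hv : n + 1 ≤ D v) (h : D a = l' → D b ≤ l' + 1) :
    Function.update D v (l + 1) a = l' → Function.update D v (l + 1) b ≤ l' + 1 := by
  intro ha
  have hav : a ≠ v := by rintro rfl; simp at ha; omega
  simp only [Function.update_of_ne hav] at ha
  have := h ha
  have hbv : b ≠ v := by rintro rfl; omega
  simpa [hbv] using this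

/-- Since no level below a reached element is empty, there are at most as many levels as elements,
so that label `n` does not occur. -/
theorem BFSInv.ne_card (hS : ∀ i < r, M.IsBase (S i)) (hD : BFSInv M S r n k D) {V : Finset α} (hV : M.E = V) (hn : V.card ≤ n)
    {v : α} (hv : v ∈ M.E) : D v ≠ n := by
  intro hvn
  have hlev : ∀ d ≤ n, ∃ w ∈ V, D w = n - d := by
    intro d
    induction d with
    | zero => exact fun _ => ⟨v, by simpa [hV] using hv, by simpa using hvn⟩
    | succ d ih =>
      intro hd
      obtain ⟨w, hw, hwd⟩ := ih (by omega)
      obtain ⟨i, hi, u, hu, hDu⟩ := hD.tight w (by simpa [hV] using hw) (by omega) (by omega)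
      have huE : u ∈ M.E := (hS i hi).subset_ground hu.1
      exact ⟨u, by simpa [hV] using huE, by omega⟩
  have hsub : Finset.range (n + 1) ⊆ V.image D := by
    intro m hm
    rw [Finset.mem_range] at hm
    obtain ⟨w, hw, hwm⟩ := hlev (n - m) (by omega)
    exact Finset.mem_image.2 ⟨w, hw, by omega⟩
  have := (Finset.card_le_card hsub).trans Finset.card_image_le
  rw [Finset.card_range] at this
  omega

theorem BFSInv.validLabel (hS : ∀ i < r, M.IsBase (S i)) (hD : BFSInv M S r n k D)
    {V : Finset α} (hV : M.E = V) (hn : V.card ≤ n) (hs : ∀ l < n, Settled M S r D l) :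
    ValidLabel M S r D := by
  intro i hi u v h
  have huE : u ∈ M.E := (hS i hi).subset_ground h.1
  have h1 := hD.le u huE
  have h2 := hD.le v h.mem_ground
  have h3 := hD.ne_card hS hV hn huE
  rcases Nat.lt_or_ge (D u) n with hlt | hge
  · exact hs _ hlt i hi u v h rfl
  · omega

/-- If the search from the elements of multiplicity at least `k` reaches no element of
multiplicity below `k - 1`, then the set of reached elements is a certificate for level `k`. -/
theorem BFSInv.levelBalanced (hS : ∀ i < r, M.IsBase (S i)) (hD : BFSInv M S r n k D)
    {V : Finset α} (hV : M.E = V) (hn : V.card ≤ n) (hs : ∀ l < n, Settled M S r D l)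
    (hno : ∀ y ∈ M.E, D y ≤ n → k ≤ mult S r y + 1) : LevelBalanced M S r k := by
  refine ⟨{v | D v ≤ n}, fun v hv hk => ?_, fun v hv h => hno v hv h, fun i hi u v hu h => ?_⟩
  · have := (hD.zero v hv).2 hk
    simp [this]
  · have huE : u ∈ M.E := (hS i hi).subset_ground h.1
    have h1 := hD.validLabel hS hV hn hs i hi u v h
    have h2 := hD.ne_card hS hV hn huE
    simp only [Set.mem_ofPred_eq] at hu ⊢
    omega

open Classical in
/-- What is true while the surplus is moved along tight arcs towards label `0`: the family `S`
consists of bases, the labels `D` are still valid and tight below the current element `y`, and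
compared to the initial multiplicities `c` one unit has been moved from `y` to `y₀`. -/
structure WalkInv (M : Matroid α) (r : ℕ) (D : α → ℕ) (c : α → ℕ) (y₀ : α) (S : ℕ → Set α)
    (y : α) : Prop where
  isBase : ∀ i < r, M.IsBase (S i)
  valid : ValidLabel M S r D
  tight : TightBelow M S r D (D y)
  mem : y ∈ M.E
  mult_eq : ∀ w, mult S r w + (if w = y then 1 else 0) = c w + (if w = y₀ then 1 else 0)

theorem WalkInv.swapFamily {c : α → ℕ} {y₀ y u : α} {i : ℕ} (h : WalkInv M r D c y₀ S y)
    (hi : i < r) (hu : M.Exch (S i) u y) (huy : D u + 1 = D y) :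
    WalkInv M r D c y₀ (swapFamily S i u y) u where
  isBase := isBase_swapFamily h.isBase hu
  valid := h.valid.swapFamily hi h.isBase hu huy
  tight := h.tight.swapFamily h.isBase h.valid le_rfl hu huy
  mem := (h.isBase i hi).subset_ground hu.1
  mult_eq w := by rw [mult_swapFamily hi hu, h.mult_eq]

theorem WalkInv.sum_sq_lt {c : α → ℕ} {y₀ y : α} (h : WalkInv M r D c y₀ S y) {V : Finset α}
    (hV : M.E = V) (hy₀ : y₀ ∈ V) (hlt : c y₀ + 1 < c y) :
    ∑ v ∈ V, mult S r v ^ 2 < ∑ v ∈ V, c v ^ 2 := by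
  classical
  have hy : y ∈ V := by simpa [hV] using h.mem
  have hne : y ≠ y₀ := by rintro rfl; omega
  have hpt : ∀ w, mult S r w ^ 2 + (if w = y then 2 * c y else 0) =
      c w ^ 2 + (if w = y₀ then 2 * c y₀ + 1 else 0) + (if w = y then 1 else 0) := by
    intro w
    have := h.mult_eq w
    by_cases h1 : w = y
    · subst h1
      simp only [if_true, hne, if_false] at this ⊢
      rw [add_zero] at this
      rw [← this]; ring
    · by_cases h2 : w = y₀
      · subst h2
        simp only [if_true, h1, if_false] at this ⊢
        rw [add_zero] at this
        rw [this]; ring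
      · simp only [h1, h2, if_false] at this ⊢
        rw [show mult S r w = c w by omega]
  have hsum := Finset.sum_congr (rfl : V = V) fun w _ => hpt w
  simp only [Finset.sum_add_distrib, Finset.sum_ite_eq', hy, hy₀, if_true] at hsum
  omega

end Labels

/-! ### Sets stored in arrays -/

/-- The set whose indicator is given by the first `n` cells of an array. -/
def suppSet (n : ℕ) (a : ℕ → ℕ) : Set ℕ := {j | j < n ∧ a j ≠ 0}

/-- The set whose indicator is given by row `i` of a matrix with `n` columns. -/
def rowSet (n : ℕ) (a : ℕ → ℕ) (i : ℕ) : Set ℕ := {j | j < n ∧ a (i * n + j) ≠ 0}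

theorem rowSet_update {n i j : ℕ} (a : ℕ → ℕ) (hj : j < n) (x : ℕ) :
    rowSet n (Function.update a (i * n + j) x) = Function.update (rowSet n a) i
      {w | w < n ∧ (if w = j then x else a (i * n + w)) ≠ 0} := by
  funext i'
  have hcell : ∀ w < n, i' * n + w = i * n + j ↔ i' = i ∧ w = j := by
    intro w hw
    refine ⟨fun h => ?_, by rintro ⟨rfl, rfl⟩; rfl⟩
    have h1 : (i' * n + w) / n = i' := by
      rw [mul_comm, Nat.mul_add_div (by omega), Nat.div_eq_of_lt hw, add_zero]
    have h2 : (i * n + j) / n = i := by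
      rw [mul_comm, Nat.mul_add_div (by omega), Nat.div_eq_of_lt hj, add_zero]
    have : i' = i := by rw [← h1, ← h2, h]
    subst this
    exact ⟨rfl, by omega⟩
  rcases eq_or_ne i' i with rfl | hne
  · simp only [Function.update_self]
    ext w
    simp only [rowSet, Set.mem_ofPred_eq]
    refine and_congr_right fun hw => ?_
    simp [Function.update_apply]
  · rw [Function.update_of_ne hne]
    ext w
    simp only [rowSet, Set.mem_ofPred_eq]
    refine and_congr_right fun hw => ?_
    rw [Function.update_of_ne]
    exact fun h => hne ((hcell w hw).1 h).1

theorem rowSet_swap {n i u v : ℕ} (a : ℕ → ℕ) (hu : u < n) (hv : v < n) (huv : u ≠ v) :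
    rowSet n (Function.update (Function.update a (i * n + u) 0) (i * n + v) 1) =
      swapFamily (rowSet n a) i u v := by
  rw [rowSet_update _ hv, rowSet_update _ hu, swapFamily, Function.update_idem]
  congr 1
  ext w
  simp only [rowSet, Set.mem_ofPred_eq, Set.mem_insert_iff, Set.mem_sdiff, Set.mem_singleton_iff,
    Function.update_apply, Nat.add_left_cancel_iff]
  by_cases h1 : w = v
  · subst h1; simp [hv]
  · by_cases h2 : w = u
    · subst h2; simp [h1]
    · simp [h1, h2]

/-! ### The program -/

namespace OracleProgram

namespace Code

/- Registers: `0` and `1` hold the input `n` and `r`; `2` is a row number and `3` the address of the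
first cell of that row; `4` and `5` are elements, `6` is a column number; `7` receives answers; `8`
is a level minus one, `9` a distance or a counter, `10` the current end of a walk; `11` says whether
a level has to be rebalanced and `12` whether the family has changed. Arrays: `0` is the matrix of
the bases, `1` the set submitted to the oracle, `2` the labels, `3` the multiplicities. -/

/-- Copy the row that starts at the address in register `3` to the array for the oracle. -/
def copyRow : Code := .forto 6 0 (.store 1 (.reg 6) (.cell 0 (.add (.reg 3) (.reg 6))))

/-- Does the row that starts at the address in register `3` have an exchange arc from the element
in register `4` to the one in register `5`? The answer is put into register `7`. -/
def testArc : Code :=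
  .seq copyRow <|
  .seq (.store 1 (.reg 4) (.const 0)) <|
  .seq (.store 1 (.reg 5) (.const 1)) <|
  .seq (.query 7 1) <|
  .cond (.cell 0 (.add (.reg 3) (.reg 4)))
    (.cond (.cell 0 (.add (.reg 3) (.reg 5))) (.assign 7 (.const 0)) .skip)
    (.assign 7 (.const 0))

/-- Run `p` for every row number in register `2`, with the address of the row in register `3`. -/
def forRows (p : Code) : Code :=
  .seq (.assign 3 (.const 0)) (.forto 2 1 (.seq p (.assign 3 (.add (.reg 3) (.reg 0)))))

/-- Run `p` for every row in registers `2`, `3` and every two elements in registers `4` and `5`. -/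
def forArcs (p : Code) : Code := forRows (.forto 4 0 (.forto 5 0 p))

/-- An expression that is zero if and only if `a` and `b` are equal. -/
def neExpr (a b : Expr) : Expr := .add (.sub a b) (.sub b a)

/-- Label the head of an arc if its tail is at the current distance and the head is not reached. -/
def labelArc : Code :=
  .cond (neExpr (.cell 2 (.reg 4)) (.reg 9)) .skip <|
  .cond (.sub (.add (.reg 0) (.const 1)) (.cell 2 (.reg 5))) .skip <|
  .seq testArc <|
  .cond (.reg 7) (.store 2 (.reg 5) (.add (.reg 9) (.const 1))) .skip

/-- If the arc is tight and leads to the current end of the walk, perform the exchange and go to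
the tail of the arc. -/
def walkArc : Code :=
  .cond (neExpr (.reg 5) (.reg 10)) .skip <|
  .cond (neExpr (.add (.cell 2 (.reg 4)) (.const 1)) (.cell 2 (.reg 5))) .skip <|
  .seq testArc <|
  .cond (.reg 7)
    (.seq (.store 0 (.add (.reg 3) (.reg 4)) (.const 0)) <|
      .seq (.store 0 (.add (.reg 3) (.reg 5)) (.const 1)) <|
      .assign 10 (.reg 4))
    .skip

/-- Compute the multiplicities. -/
def countMult : Code :=
  .forto 5 0 <|
  .seq (.store 3 (.reg 5) (.const 0)) <|
  forRows <| .cond (.cell 0 (.add (.reg 3) (.reg 5)))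
    (.store 3 (.reg 5) (.add (.cell 3 (.reg 5)) (.const 1))) .skip

/-- Give label `0` to the elements whose multiplicity reaches the level, and `n + 1` to the
others. -/
def initLabels : Code :=
  .forto 5 0 <|
  .cond (.sub (.add (.reg 8) (.const 1)) (.cell 3 (.reg 5)))
    (.store 2 (.reg 5) (.add (.reg 0) (.const 1)))
    (.store 2 (.reg 5) (.const 0))

/-- Look for a reached element whose multiplicity is below the level by at least two. -/
def findEnd : Code :=
  .seq (.assign 11 (.const 0)) <|
  .forto 5 0 <|
  .cond (.sub (.add (.reg 8) (.const 1)) (.add (.cell 3 (.reg 5)) (.const 1)))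
    (.cond (.sub (.add (.reg 0) (.const 1)) (.cell 2 (.reg 5)))
      (.seq (.assign 10 (.reg 5)) (.assign 11 (.const 1))) .skip)
    .skip

/-- Search from the elements whose multiplicity reaches the level, and improve the family if this
leads to an element whose multiplicity is too small. -/
def balanceLevel : Code :=
  .seq countMult <|
  .seq initLabels <|
  .seq (.forto 9 0 (forArcs labelArc)) <|
  .seq findEnd <|
  .cond (.reg 11) (.seq (.forto 9 0 (forArcs walkArc)) (.assign 12 (.const 1))) .skip

/-- Try to improve the family at every level. -/
def balanceAll : Code := .seq (.assign 12 (.const 0)) (.forto 8 1 balanceLevel)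

/-- Find a base greedily. -/
def greedyBase : Code :=
  .forto 5 0 <|
  .seq (.store 1 (.reg 5) (.const 1)) <|
  .seq (.query 7 1) <|
  .cond (.reg 7) .skip (.store 1 (.reg 5) (.const 0))

/-- Copy the base into all rows of the matrix. -/
def copyBase : Code :=
  forRows <| .forto 5 0 <| .store 0 (.add (.reg 3) (.reg 5)) (.cell 1 (.reg 5))

end Code

/-- Starting with equal bases, improve the family until every level is balanced. -/
def balanceProgram : Program :=
  .seq (Code.seq (.seq Code.greedyBase Code.copyBase) (.assign 12 (.const 1))).toProgram
    (.loop (.reg 12) Code.balanceAll.toProgram)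

/-! ### Correctness of the program -/

namespace Code

variable {n r : ℕ} {M : Matroid ℕ}

/-- The answers of an independence oracle for a matroid on `0, …, n - 1`. -/
def indepAsk (M : Matroid ℕ) (n : ℕ) (a : ℕ → ℕ) : Prop := M.Indep (suppSet n a)

/-- `P` is preserved when the registers `2` to `5`, which are used by loops over rows and elements,
are overwritten. -/
def LoopFree (P : State → Prop) : Prop :=
  ∀ s x v, 2 ≤ x → x ≤ 5 → P s → P (s.setReg x v)

theorem run_forRows_induction {ask : (ℕ → ℕ) → Prop} {p : Code} (I : ℕ → State → Prop)
    (hp : ∀ y < 4, p.writesReg y = false) (hI : ∀ j, LoopFree (I j)) {s : State}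
    (h0 : s.reg 0 = n) (h1 : s.reg 1 = r) (hs : I 0 s)
    (hstep : ∀ i < r, ∀ s', s'.reg 0 = n → s'.reg 1 = r → s'.reg 2 = i → s'.reg 3 = i * n →
      (∀ y, 3 < y → p.writesReg y = false → s'.reg y = s.reg y) →
      I i s' → I (i + 1) (p.run ask s')) :
    I r ((forRows p).run ask s) := by
  simp only [forRows, run, Expr.eval]
  have key := run_forto_induction (ask := ask) (x := 2) (b := 1)
    (p := .seq p (.assign 3 (.add (.reg 3) (.reg 0)))) (s := s.setReg 3 0)
    (fun j s' => s'.reg 3 = j * n ∧ I j s')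
    (by simp [writesReg, hp 2 (by norm_num)])
    ⟨by simp, hI _ _ _ _ (by norm_num) (by norm_num) (hI _ _ _ _ (by norm_num) (by norm_num) hs)⟩
    (by
      rintro j hj s' h2 hreg - ⟨h3, hIj⟩
      have e0 : s'.reg 0 = n := by
        rw [hreg 0 (by simp [writesReg, hp 0 (by norm_num)])]; simpa using h0
      have e1 : s'.reg 1 = r := by
        rw [hreg 1 (by simp [writesReg, hp 1 (by norm_num)])]; simpa using h1
      simp only [State.reg_setReg, Function.update_of_ne (show (1 : ℕ) ≠ 3 by norm_num), h1] at hj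
      have hnew := hstep j hj s' e0 e1 h2 h3 (by
        intro y hy hpy
        rw [hreg y (by simp [writesReg, hpy]; omega)]
        simp [show y ≠ 3 by omega]) hIj
      constructor
      · simp only [run, Expr.eval, State.reg_setReg]
        rw [Function.update_of_ne (by norm_num), Function.update_self,
          run_reg_of_writesReg (hp 3 (by norm_num)), run_reg_of_writesReg (hp 0 (by norm_num)), h3,
          e0]
        ring
      · exact hI _ _ _ _ (by norm_num) (by norm_num)
          (hI _ _ _ _ (by norm_num) (by norm_num) hnew))
  have e : (s.setReg 3 0).reg 1 = r := by simpa using h1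
  rw [e] at key
  exact key.2

/-- The rule for loops over all triples of a row and two elements: an invariant `J` is kept, and
a stable property `G i u v` that is established by the pass for `i`, `u`, `v` holds in the end. -/
theorem run_forArcs {ask : (ℕ → ℕ) → Prop} {p : Code} (J : State → Prop)
    (G : ℕ → ℕ → ℕ → State → Prop) (hp : ∀ y < 6, p.writesReg y = false) (hJ : LoopFree J)
    (hG : ∀ i u v, LoopFree (G i u v)) {s : State} (h0 : s.reg 0 = n) (h1 : s.reg 1 = r)
    (hs : J s)
    (hstep : ∀ i < r, ∀ u < n, ∀ v < n, ∀ s', s'.reg 0 = n → s'.reg 3 = i * n → s'.reg 4 = u →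
      s'.reg 5 = v → J s' → J (p.run ask s') ∧ G i u v (p.run ask s') ∧
        ∀ i' u' v', G i' u' v' s' → G i' u' v' (p.run ask s')) :
    J ((forArcs p).run ask s) ∧
      ∀ i < r, ∀ u < n, ∀ v < n, G i u v ((forArcs p).run ask s) := by
  -- One pass of the loop over the second element.
  have inner : ∀ i < r, ∀ u < n, ∀ s', s'.reg 0 = n → s'.reg 3 = i * n → s'.reg 4 = u → J s' →
      J ((forto 5 0 p).run ask s') ∧ (∀ v < n, G i u v ((forto 5 0 p).run ask s')) ∧
        ∀ i' u' v', G i' u' v' s' → G i' u' v' ((forto 5 0 p).run ask s') := by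
    intro i hi u hu s' e0 e3 e4 hJs
    have key := run_forto_induction (ask := ask) (x := 5) (b := 0) (p := p) (s := s')
      (fun j t => J t ∧ (∀ v < j, G i u v t) ∧ ∀ i' u' v', G i' u' v' s' → G i' u' v' t)
      (hp 5 (by norm_num))
      ⟨hJ _ _ _ (by norm_num) (by norm_num) hJs, by simp,
        fun i' u' v' h => hG _ _ _ _ _ _ (by norm_num) (by norm_num) h⟩
      (by
        rintro j hj t e5 hreg - ⟨ht1, ht2, ht3⟩
        rw [e0] at hj
        obtain ⟨g1, g2, g3⟩ := hstep i hi u hu j hj t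
          (by rw [hreg 0 (by simp [writesReg, hp]), e0])
          (by rw [hreg 3 (by simp [writesReg, hp]), e3])
          (by rw [hreg 4 (by simp [writesReg, hp]), e4]) e5 ht1
        refine ⟨hJ _ _ _ (by norm_num) (by norm_num) g1, fun v hv => ?_, fun i' u' v' h => ?_⟩
        · refine hG _ _ _ _ _ _ (by norm_num) (by norm_num) ?_
          rcases Nat.lt_succ_iff_lt_or_eq.1 hv with hv | rfl
          · exact g3 _ _ _ (ht2 v hv)
          · exact g2
        · exact hG _ _ _ _ _ _ (by norm_num) (by norm_num) (g3 _ _ _ (ht3 _ _ _ h)))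
    rwa [e0] at key
  -- One pass of the loop over the first element.
  have middle : ∀ i < r, ∀ s', s'.reg 0 = n → s'.reg 3 = i * n → J s' →
      J ((forto 4 0 (forto 5 0 p)).run ask s') ∧
        (∀ u < n, ∀ v < n, G i u v ((forto 4 0 (forto 5 0 p)).run ask s')) ∧
        ∀ i' u' v', G i' u' v' s' → G i' u' v' ((forto 4 0 (forto 5 0 p)).run ask s') := by
    intro i hi s' e0 e3 hJs
    have key := run_forto_induction (ask := ask) (x := 4) (b := 0) (p := forto 5 0 p) (s := s')
      (fun j t => J t ∧ (∀ u < j, ∀ v < n, G i u v t) ∧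
        ∀ i' u' v', G i' u' v' s' → G i' u' v' t)
      (by simp [writesReg, hp])
      ⟨hJ _ _ _ (by norm_num) (by norm_num) hJs, by simp,
        fun i' u' v' h => hG _ _ _ _ _ _ (by norm_num) (by norm_num) h⟩
      (by
        rintro j hj t e4 hreg - ⟨ht1, ht2, ht3⟩
        rw [e0] at hj
        obtain ⟨g1, g2, g3⟩ := inner i hi j hj t
          (by rw [hreg 0 (by simp [writesReg, hp]), e0])
          (by rw [hreg 3 (by simp [writesReg, hp]), e3]) e4 ht1
        refine ⟨hJ _ _ _ (by norm_num) (by norm_num) g1, fun u hu v hv => ?_,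
          fun i' u' v' h => ?_⟩
        · refine hG _ _ _ _ _ _ (by norm_num) (by norm_num) ?_
          rcases Nat.lt_succ_iff_lt_or_eq.1 hu with hu | rfl
          · exact g3 _ _ _ (ht2 u hu v hv)
          · exact g2 v hv
        · exact hG _ _ _ _ _ _ (by norm_num) (by norm_num) (g3 _ _ _ (ht3 _ _ _ h)))
    rwa [e0] at key
  refine run_forRows_induction (I := fun j t => J t ∧ ∀ i < j, ∀ u < n, ∀ v < n, G i u v t)
    (fun y hy => by
      have := hp y (by omega)
      simp [writesReg, this]; omega) ?_ h0 h1 ⟨hs, by simp⟩ ?_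
  · rintro j t x v hx hx' ⟨ht1, ht2⟩
    exact ⟨hJ _ _ _ hx hx' ht1, fun i hi u hu v hv => hG _ _ _ _ _ _ hx hx' (ht2 i hi u hu v hv)⟩
  · rintro i hi t e0 - - e3 - ⟨ht1, ht2⟩
    obtain ⟨g1, g2, g3⟩ := middle i hi t e0 e3 ht1
    refine ⟨g1, fun i' hi' u hu v hv => ?_⟩
    rcases Nat.lt_succ_iff_lt_or_eq.1 hi' with hi' | rfl
    · exact g3 _ _ _ (ht2 i' hi' u hu v hv)
    · exact g2 u hu v hv

theorem run_copyRow {ask : (ℕ → ℕ) → Prop} {s : State} {w : ℕ} (hw : w < s.reg 0) :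
    (copyRow.run ask s).arr 1 w = s.arr 0 (s.reg 3 + w) := by
  refine run_forto_induction (ask := ask) (x := 6) (b := 0)
    (p := .store 1 (.reg 6) (.cell 0 (.add (.reg 3) (.reg 6)))) (s := s)
    (fun j t => ∀ w < j, t.arr 1 w = s.arr 0 (s.reg 3 + w)) rfl (by simp) ?_ w hw
  intro j hj t e6 hreg harr ht w hw
  simp only [run_store, Expr.eval, e6, State.arr_setReg, State.arr_setCell, Function.update_self]
  rw [harr 0 rfl, hreg 3 rfl]
  rcases Nat.lt_succ_iff_lt_or_eq.1 hw with hw | rfl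
  · rw [Function.update_of_ne hw.ne, ht w hw]
  · rw [Function.update_self]

theorem run_testArc {s : State} {i : ℕ} (h0 : s.reg 0 = n) (h3 : s.reg 3 = i * n)
    (hu : s.reg 4 < n) (hv : s.reg 5 < n) :
    (testArc.run (indepAsk M n) s).reg 7 ≠ 0 ↔
      M.Exch (rowSet n (s.arr 0) i) (s.reg 4) (s.reg 5) := by
  have hcopy : ∀ w < n, (copyRow.run (indepAsk M n) s).arr 1 w = s.arr 0 (i * n + w) :=
    fun w hw => h3 ▸ run_copyRow (h0 ▸ hw)
  have e3 : (copyRow.run (indepAsk M n) s).reg 3 = i * n := by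
    rw [← h3]; exact run_reg_of_writesReg rfl s
  have e4 : (copyRow.run (indepAsk M n) s).reg 4 = s.reg 4 := run_reg_of_writesReg rfl s
  have e5 : (copyRow.run (indepAsk M n) s).reg 5 = s.reg 5 := run_reg_of_writesReg rfl s
  have a0 : (copyRow.run (indepAsk M n) s).arr 0 = s.arr 0 := run_arr_of_writesArr rfl s
  have hmemu : s.reg 4 ∈ rowSet n (s.arr 0) i ↔ s.arr 0 (i * n + s.reg 4) ≠ 0 := by
    simp [rowSet, hu]
  have hmemv : s.reg 5 ∈ rowSet n (s.arr 0) i ↔ s.arr 0 (i * n + s.reg 5) ≠ 0 := by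
    simp [rowSet, hv]
  rw [Matroid.Exch, hmemu, hmemv]
  by_cases hu0 : s.arr 0 (i * n + s.reg 4) = 0
  · simp [testArc, Expr.eval, e3, e4, a0, hu0]
  by_cases hv0 : s.arr 0 (i * n + s.reg 5) = 0
  swap
  · simp [testArc, Expr.eval, e3, e4, e5, a0, hu0, hv0]
  have hset : suppSet n (Function.update (Function.update
      ((copyRow.run (indepAsk M n) s).arr 1) (s.reg 4) 0) (s.reg 5) 1) =
      insert (s.reg 5) (rowSet n (s.arr 0) i \ {s.reg 4}) := by
    ext w
    simp only [suppSet, rowSet, Set.mem_ofPred_eq, Set.mem_insert_iff, Set.mem_sdiff,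
      Set.mem_singleton_iff, Function.update_apply]
    by_cases h5 : w = s.reg 5
    · simp [h5, hv]
    · by_cases h4 : w = s.reg 4
      · rw [h4] at h5
        simp [h4, h5]
      · simp only [h5, h4, if_false, false_or, not_false_eq_true, and_true]
        exact and_congr_right fun hw => by rw [hcopy w hw]
  simp only [testArc, run_seq, run_store, Expr.eval, State.reg_setCell, e4, e5]
  rw [run_cond_of_ne_zero, run_cond_of_eq_zero]
  · rw [run_skip, run_query_reg_ne_zero]
    simp [indepAsk, hset, hu0, hv0]
  · simp [Expr.eval, e3, e5, a0, hv0]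
  · simp [Expr.eval, e3, e4, a0, hu0]

open Classical in
theorem run_labelArc {s : State} {i : ℕ} (h0 : s.reg 0 = n) (h3 : s.reg 3 = i * n)
    (hu : s.reg 4 < n) (hv : s.reg 5 < n) :
    (labelArc.run (indepAsk M n) s).arr 2 =
      if s.arr 2 (s.reg 4) = s.reg 9 ∧ n + 1 ≤ s.arr 2 (s.reg 5) ∧
          M.Exch (rowSet n (s.arr 0) i) (s.reg 4) (s.reg 5)
        then Function.update (s.arr 2) (s.reg 5) (s.reg 9 + 1) else s.arr 2 := by
  have ht := run_testArc (M := M) h0 h3 hu hv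
  have e5 : (testArc.run (indepAsk M n) s).reg 5 = s.reg 5 := run_reg_of_writesReg rfl s
  have e9 : (testArc.run (indepAsk M n) s).reg 9 = s.reg 9 := run_reg_of_writesReg rfl s
  have a2 : (testArc.run (indepAsk M n) s).arr 2 = s.arr 2 := run_arr_of_writesArr rfl s
  rw [labelArc]
  by_cases h1 : s.arr 2 (s.reg 4) = s.reg 9
  swap
  · rw [run_cond_of_ne_zero (by simp only [neExpr, Expr.eval]; omega), if_neg (fun h => h1 h.1),
      run_skip]
  rw [run_cond_of_eq_zero (by simp only [neExpr, Expr.eval]; omega)]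
  by_cases h2 : n + 1 ≤ s.arr 2 (s.reg 5)
  swap
  · rw [run_cond_of_ne_zero (by simp only [Expr.eval]; omega), if_neg (fun h => h2 h.2.1),
      run_skip]
  rw [run_cond_of_eq_zero (by simp only [Expr.eval]; omega), run_seq]
  by_cases h4 : M.Exch (rowSet n (s.arr 0) i) (s.reg 4) (s.reg 5)
  · rw [run_cond_of_ne_zero (b := .reg 7) (ht.2 h4), if_pos ⟨h1, h2, h4⟩]
    simp [Expr.eval, e5, e9, a2]
  · rw [run_cond_of_eq_zero (b := .reg 7) (by_contra fun h => h4 (ht.1 h)), if_neg (fun h => h4 h.2.2)]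
    simp [a2]

/-- The effect of `walkArc`: either an exchange along a tight arc that ends at the current end of
the walk, or nothing. -/
theorem run_walkArc {s : State} {i : ℕ} (h0 : s.reg 0 = n) (h3 : s.reg 3 = i * n)
    (hu : s.reg 4 < n) (hv : s.reg 5 < n) :
    (s.reg 5 = s.reg 10 ∧ s.arr 2 (s.reg 4) + 1 = s.arr 2 (s.reg 5) ∧
        M.Exch (rowSet n (s.arr 0) i) (s.reg 4) (s.reg 5) ∧
        rowSet n ((walkArc.run (indepAsk M n) s).arr 0) =
          swapFamily (rowSet n (s.arr 0)) i (s.reg 4) (s.reg 5) ∧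
        (walkArc.run (indepAsk M n) s).reg 10 = s.reg 4) ∨
      (¬ (s.reg 5 = s.reg 10 ∧ s.arr 2 (s.reg 4) + 1 = s.arr 2 (s.reg 5) ∧
        M.Exch (rowSet n (s.arr 0) i) (s.reg 4) (s.reg 5)) ∧
        (walkArc.run (indepAsk M n) s).arr 0 = s.arr 0 ∧
        (walkArc.run (indepAsk M n) s).reg 10 = s.reg 10) := by
  have ht := run_testArc (M := M) h0 h3 hu hv
  have e3 : (testArc.run (indepAsk M n) s).reg 3 = i * n := by
    rw [← h3]; exact run_reg_of_writesReg rfl s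
  have e4 : (testArc.run (indepAsk M n) s).reg 4 = s.reg 4 := run_reg_of_writesReg rfl s
  have e5 : (testArc.run (indepAsk M n) s).reg 5 = s.reg 5 := run_reg_of_writesReg rfl s
  have e10 : (testArc.run (indepAsk M n) s).reg 10 = s.reg 10 := run_reg_of_writesReg rfl s
  have a0 : (testArc.run (indepAsk M n) s).arr 0 = s.arr 0 := run_arr_of_writesArr rfl s
  rw [walkArc]
  by_cases h1 : s.reg 5 = s.reg 10
  swap
  · rw [run_cond_of_ne_zero (by simp only [neExpr, Expr.eval]; omega)]
    exact .inr ⟨fun h => h1 h.1, rfl, rfl⟩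
  rw [run_cond_of_eq_zero (by simp only [neExpr, Expr.eval]; omega)]
  by_cases h2 : s.arr 2 (s.reg 4) + 1 = s.arr 2 (s.reg 5)
  swap
  · rw [run_cond_of_ne_zero (by simp only [neExpr, Expr.eval]; omega)]
    exact .inr ⟨fun h => h2 h.2.1, rfl, rfl⟩
  rw [run_cond_of_eq_zero (by simp only [neExpr, Expr.eval]; omega), run_seq]
  by_cases h4 : M.Exch (rowSet n (s.arr 0) i) (s.reg 4) (s.reg 5)
  · rw [run_cond_of_ne_zero (b := .reg 7) (ht.2 h4)]
    refine .inl ⟨h1, h2, h4, ?_, by simp [Expr.eval, e4]⟩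
    have huv : s.reg 4 ≠ s.reg 5 := fun e => h4.2.1 (e ▸ h4.1)
    simp only [run_seq, run_assign, run_store, Expr.eval, State.reg_setCell, State.arr_setReg,
      State.arr_setCell, Function.update_self, e3, e4, e5, a0]
    exact rowSet_swap _ hu hv huv
  · rw [run_cond_of_eq_zero (b := .reg 7) (by_contra fun h => h4 (ht.1 h))]
    exact .inr ⟨fun h => h4 h.2.2, by simp [a0], by simp [e10]⟩

theorem run_countMult {ask : (ℕ → ℕ) → Prop} {s : State} (h0 : s.reg 0 = n) (h1 : s.reg 1 = r) :
    ∀ v < n, (countMult.run ask s).arr 3 v = mult (rowSet n (s.arr 0)) r v := by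
  classical
  have key := run_forto_induction (ask := ask) (x := 5) (b := 0) (s := s)
    (p := .seq (.store 3 (.reg 5) (.const 0)) <|
      forRows <| .cond (.cell 0 (.add (.reg 3) (.reg 5)))
        (.store 3 (.reg 5) (.add (.cell 3 (.reg 5)) (.const 1))) .skip)
    (fun j t => ∀ v < j, t.arr 3 v = mult (rowSet n (s.arr 0)) r v) (by rfl) (by simp) ?_
  · rwa [h0] at key
  intro v hv t e5 hreg harr ht
  rw [h0] at hv
  rw [run_seq, run_store]
  set t₁ := t.setCell 3 (Expr.eval t (.reg 5)) (Expr.eval t (.const 0)) with ht₁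
  have hrow := run_forRows_induction (ask := ask) (n := n) (r := r)
    (p := .cond (.cell 0 (.add (.reg 3) (.reg 5)))
        (.store 3 (.reg 5) (.add (.cell 3 (.reg 5)) (.const 1))) .skip) (s := t₁)
    (fun i t' => t'.arr 0 = s.arr 0 ∧
      t'.arr 3 = Function.update (t.arr 3) v (mult (rowSet n (s.arr 0)) i v))
    (fun _ _ => rfl) (fun _ _ _ _ _ _ h => h)
    (by rw [← h0]; exact hreg 0 rfl) (by rw [← h1]; exact hreg 1 rfl)
    ⟨harr 0 rfl, by simp [ht₁, Expr.eval, e5, mult]⟩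
    (by
      rintro i hi t' g0 g1 g2 g3 hr ⟨ha, hb⟩
      have g5 : t'.reg 5 = v := by rw [hr 5 (by norm_num) rfl]; exact e5
      have hmem : v ∈ rowSet n (s.arr 0) i ↔ s.arr 0 (i * n + v) ≠ 0 := by simp [rowSet, hv]
      have hcell : Expr.eval t' (.cell 0 (.add (.reg 3) (.reg 5))) = s.arr 0 (i * n + v) := by
        simp [Expr.eval, g3, g5, ha]
      rw [mult_succ]
      by_cases hz : s.arr 0 (i * n + v) = 0
      · rw [run_cond_of_eq_zero (by rw [hcell, hz]), if_neg (by simp [hmem, hz])]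
        exact ⟨ha, hb⟩
      · rw [run_cond_of_ne_zero (by rwa [hcell]), if_pos (by simp [hmem, hz])]
        exact ⟨ha, by simp [Expr.eval, g5, hb]⟩)
  intro w hw
  rw [State.arr_setReg, hrow.2]
  rcases Nat.lt_succ_iff_lt_or_eq.1 hw with hw | rfl
  · rw [Function.update_of_ne hw.ne, ht w hw]
  · rw [Function.update_self]

theorem run_initLabels {ask : (ℕ → ℕ) → Prop} {s : State} (h0 : s.reg 0 = n) :
    ∀ v < n, (initLabels.run ask s).arr 2 v = if s.reg 8 + 1 ≤ s.arr 3 v then 0 else n + 1 := by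
  have key := run_forto_induction (ask := ask) (x := 5) (b := 0) (s := s)
    (p := .cond (.sub (.add (.reg 8) (.const 1)) (.cell 3 (.reg 5)))
      (.store 2 (.reg 5) (.add (.reg 0) (.const 1))) (.store 2 (.reg 5) (.const 0)))
    (fun j t => ∀ v < j, t.arr 2 v = if s.reg 8 + 1 ≤ s.arr 3 v then 0 else n + 1)
    rfl (by simp) ?_
  · rwa [h0] at key
  intro v _ t e5 hreg harr ht w hw
  have e8 : t.reg 8 = s.reg 8 := hreg 8 rfl
  have e0 : t.reg 0 = n := by rw [← h0]; exact hreg 0 rfl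
  have a3 : t.arr 3 = s.arr 3 := harr 3 rfl
  have hstep : ((cond (.sub (.add (.reg 8) (.const 1)) (.cell 3 (.reg 5)))
      (.store 2 (.reg 5) (.add (.reg 0) (.const 1))) (.store 2 (.reg 5) (.const 0))).run ask
      t).arr 2 = Function.update (t.arr 2) v (if s.reg 8 + 1 ≤ s.arr 3 v then 0 else n + 1) := by
    by_cases h : s.reg 8 + 1 ≤ s.arr 3 v
    · rw [run_cond_of_eq_zero (by simp only [Expr.eval, e8, e5, a3]; omega), if_pos h]
      simp [Expr.eval, e5]
    · rw [run_cond_of_ne_zero (by simp only [Expr.eval, e8, e5, a3]; omega), if_neg h]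
      simp [Expr.eval, e5, e0]
  rw [State.arr_setReg, hstep]
  rcases Nat.lt_succ_iff_lt_or_eq.1 hw with hw | rfl
  · rw [Function.update_of_ne hw.ne, ht w hw]
  · rw [Function.update_self]

/-- The breadth-first search computes valid labels. During round `l` every element that has been
reached has a label at most `l + 1`. -/
theorem run_labels (hE : M.E = Set.Iio n) {k : ℕ} {s : State} (h0 : s.reg 0 = n)
    (h1 : s.reg 1 = r) (hS : ∀ i < r, M.IsBase (rowSet n (s.arr 0) i))
    (hD : BFSInv M (rowSet n (s.arr 0)) r n k (s.arr 2))
    (hD0 : ∀ v ∈ M.E, s.arr 2 v ≤ n → s.arr 2 v = 0) :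
    BFSInv M (rowSet n (s.arr 0)) r n k
        (((forto 9 0 (forArcs labelArc)).run (indepAsk M n) s).arr 2) ∧
      ∀ l < n, Settled M (rowSet n (s.arr 0)) r
        (((forto 9 0 (forArcs labelArc)).run (indepAsk M n) s).arr 2) l := by
  have hlt : ∀ v ∈ M.E, v < n := fun v hv => by simpa [hE] using hv
  have key := run_forto_induction (ask := indepAsk M n) (x := 9) (b := 0) (s := s)
    (p := forArcs labelArc)
    (fun l t => BFSInv M (rowSet n (s.arr 0)) r n k (t.arr 2) ∧
      (∀ v ∈ M.E, t.arr 2 v ≤ n → t.arr 2 v ≤ l) ∧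
      ∀ l' < l, Settled M (rowSet n (s.arr 0)) r (t.arr 2) l') rfl
    ⟨hD, fun v hv h => (hD0 v hv h).le, by simp⟩ ?_
  · rw [h0] at key
    exact ⟨key.1, key.2.2⟩
  rintro l hl t e9 hreg harr ⟨ht1, htl, ht2⟩
  rw [h0] at hl
  obtain ⟨⟨-, -, g2, gl, gs⟩, hG⟩ := run_forArcs (ask := indepAsk M n) (n := n) (r := r)
    (p := labelArc) (s := t)
    (fun t => t.arr 0 = s.arr 0 ∧ t.reg 9 = l ∧
      BFSInv M (rowSet n (s.arr 0)) r n k (t.arr 2) ∧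
      (∀ v ∈ M.E, t.arr 2 v ≤ n → t.arr 2 v ≤ l + 1) ∧
      ∀ l' < l, Settled M (rowSet n (s.arr 0)) r (t.arr 2) l')
    (fun i u v t => M.Exch (rowSet n (s.arr 0) i) u v → t.arr 2 u = l → t.arr 2 v ≤ l + 1)
    (by decide)
    (fun s x v hx hx' h => ⟨h.1, by simpa [show 9 ≠ x by omega] using h.2.1, h.2.2⟩)
    (fun _ _ _ _ _ _ _ _ h => h)
    (by rw [← h0]; exact hreg 0 rfl) (by rw [← h1]; exact hreg 1 rfl)
    ⟨harr 0 rfl, e9, ht1, fun v hv h => (htl v hv h).trans (Nat.le_succ l), ht2⟩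
    (by
      classical
      rintro i hi u hu v hv t' g0 g3 rfl rfl ⟨f0, f9, f2, fl, fs⟩
      have b0 : (labelArc.run (indepAsk M n) t').arr 0 = t'.arr 0 := run_arr_of_writesArr rfl t'
      have b9 : (labelArc.run (indepAsk M n) t').reg 9 = t'.reg 9 := run_reg_of_writesReg rfl t'
      have b2 := run_labelArc (M := M) g0 g3 hu hv
      rw [f0, f9] at b2
      rw [b0, b9, f0, f9, b2]
      split_ifs with hc
      · obtain ⟨c1, c2, c3⟩ := hc
        refine ⟨⟨rfl, rfl, f2.update hi c3 hl c1 c2, fun w hw => ?_,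
          fun l' hl' j hj a b hab => ?_⟩, fun _ _ => by simp, fun i' u' v' hG hab => ?_⟩
        · rcases eq_or_ne w (t'.reg 5) with rfl | hne
          · simp
          · simpa [hne] using fl w hw
        · exact le_update_of_le hl hl'.le c2 (fs l' hl' j hj a b hab)
        · exact le_update_of_le hl le_rfl c2 (hG hab)
      · refine ⟨⟨rfl, rfl, f2, fl, fs⟩, fun hex hul => ?_, fun _ _ _ h => h⟩
        refine fl _ hex.mem_ground ?_
        by_contra hgt
        exact hc ⟨hul, by omega, hex⟩)
  refine ⟨g2, gl, fun l' hl' => ?_⟩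
  rcases Nat.lt_succ_iff_lt_or_eq.1 hl' with hl' | rfl
  · exact gs l' hl'
  · intro i hi u v h
    exact hG i hi u (hlt u ((hS i hi).subset_ground h.1)) v (hlt v h.mem_ground) h

theorem run_findEnd {ask : (ℕ → ℕ) → Prop} {s : State} (h0 : s.reg 0 = n) :
    ((findEnd.run ask s).reg 11 ≠ 0 → (findEnd.run ask s).reg 10 < n ∧
        s.arr 3 ((findEnd.run ask s).reg 10) + 2 ≤ s.reg 8 + 1 ∧
        s.arr 2 ((findEnd.run ask s).reg 10) ≤ n) ∧
      ((findEnd.run ask s).reg 11 = 0 →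
        ∀ y < n, s.arr 2 y ≤ n → s.reg 8 + 1 ≤ s.arr 3 y + 1) := by
  have key := run_forto_induction (ask := ask) (x := 5) (b := 0)
    (s := s.setReg 11 (Expr.eval s (.const 0)))
    (p := .cond (.sub (.add (.reg 8) (.const 1)) (.add (.cell 3 (.reg 5)) (.const 1)))
      (.cond (.sub (.add (.reg 0) (.const 1)) (.cell 2 (.reg 5)))
        (.seq (.assign 10 (.reg 5)) (.assign 11 (.const 1))) .skip) .skip)
    (fun j t => (t.reg 11 ≠ 0 → t.reg 10 < n ∧ s.arr 3 (t.reg 10) + 2 ≤ s.reg 8 + 1 ∧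
        s.arr 2 (t.reg 10) ≤ n) ∧
      (t.reg 11 = 0 → ∀ y < j, s.arr 2 y ≤ n → s.reg 8 + 1 ≤ s.arr 3 y + 1))
    rfl (by simp [Expr.eval]) ?_
  · have e0 : (s.setReg 11 (Expr.eval s (.const 0))).reg 0 = n := by simpa using h0
    rw [e0] at key
    exact key
  rintro y hy t e5 hreg harr ⟨ht1, ht2⟩
  have hy' : y < n := by simpa [h0] using hy
  have e8 : t.reg 8 = s.reg 8 := hreg 8 rfl
  have e0 : t.reg 0 = n := by rw [← h0]; exact hreg 0 rfl
  have a2 : t.arr 2 = s.arr 2 := harr 2 rfl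
  have a3 : t.arr 3 = s.arr 3 := harr 3 rfl
  have hskip : (s.arr 2 y ≤ n → s.reg 8 + 1 ≤ s.arr 3 y + 1) → (t.reg 11 = 0 →
      ∀ w < y + 1, s.arr 2 w ≤ n → s.reg 8 + 1 ≤ s.arr 3 w + 1) := by
    intro h h11 w hw
    rcases Nat.lt_succ_iff_lt_or_eq.1 hw with hw | rfl
    · exact ht2 h11 w hw
    · exact h
  by_cases hk : s.reg 8 + 1 ≤ s.arr 3 y + 1
  · rw [run_cond_of_eq_zero (by simp only [Expr.eval, e8, e5, a3]; omega), run_skip]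
    exact ⟨ht1, hskip fun _ => hk⟩
  rw [run_cond_of_ne_zero (by simp only [Expr.eval, e8, e5, a3]; omega)]
  by_cases hn : s.arr 2 y ≤ n
  · rw [run_cond_of_ne_zero (by simp only [Expr.eval, e0, e5, a2]; omega)]
    simp only [run_seq, run_assign, Expr.eval, e5]
    exact ⟨fun _ => ⟨hy', by change s.arr 3 y + 2 ≤ _; omega, hn⟩, fun h => absurd h one_ne_zero⟩
  · rw [run_cond_of_eq_zero (by simp only [Expr.eval, e0, e5, a2]; omega), run_skip]
    exact ⟨ht1, hskip fun h => absurd h hn⟩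

/-- One pass over all arcs keeps the invariant of the walk, and moves its end to a smaller label
unless the label is already zero. -/
theorem run_forArcs_walkArc (hE : M.E = Set.Iio n) {D c : ℕ → ℕ} {y₀ : ℕ} {s : State}
    (h0 : s.reg 0 = n) (h1 : s.reg 1 = r) (hD : s.arr 2 = D)
    (h : WalkInv M r D c y₀ (rowSet n (s.arr 0)) (s.reg 10)) :
    WalkInv M r D c y₀ (rowSet n (((forArcs walkArc).run (indepAsk M n) s).arr 0))
        (((forArcs walkArc).run (indepAsk M n) s).reg 10) ∧
      (D (((forArcs walkArc).run (indepAsk M n) s).reg 10) < D (s.reg 10) ∨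
        D (((forArcs walkArc).run (indepAsk M n) s).reg 10) = 0) := by
  have hlt : ∀ v ∈ M.E, v < n := fun v hv => by simpa [hE] using hv
  set y := s.reg 10 with hy
  obtain ⟨⟨-, gw, gm⟩, hG⟩ := run_forArcs (ask := indepAsk M n) (n := n) (r := r)
    (p := walkArc) (s := s)
    (fun t => t.arr 2 = D ∧ WalkInv M r D c y₀ (rowSet n (t.arr 0)) (t.reg 10) ∧
      (D (t.reg 10) < D y ∨ (t.arr 0 = s.arr 0 ∧ t.reg 10 = y)))
    (fun i u v t => D (t.reg 10) < D y ∨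
      ¬ (v = y ∧ D u + 1 = D v ∧ M.Exch (rowSet n (s.arr 0) i) u v))
    (by decide)
    (fun s x v hx hx' h => by simpa [show 10 ≠ x by omega] using h)
    (fun _ _ _ s x v hx hx' h => by simpa [show 10 ≠ x by omega] using h)
    h0 h1 ⟨hD, h, .inr ⟨rfl, rfl⟩⟩
    (by
      rintro i hi u hu v hv t g0 g3 rfl rfl ⟨f2, fw, fm⟩
      have b2 : (walkArc.run (indepAsk M n) t).arr 2 = t.arr 2 := run_arr_of_writesArr rfl t
      have hle : D (t.reg 10) ≤ D y := by
        rcases fm with fm | ⟨-, fm⟩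
        · exact fm.le
        · rw [fm]
      rw [b2, f2]
      rcases run_walkArc (M := M) g0 g3 hu hv with ⟨w1, w2, w3, w4, w5⟩ | ⟨w1, w2, w3⟩
      · rw [f2] at w2
        have hless : D (t.reg 4) < D y := by rw [w1] at w2; omega
        rw [w4, w5]
        refine ⟨⟨rfl, ?_, .inl hless⟩, .inl hless, fun _ _ _ _ => .inl hless⟩
        rw [w1] at w2 w3 ⊢
        exact fw.swapFamily hi w3 w2
      · rw [f2] at w1
        rw [w2, w3]
        refine ⟨⟨rfl, fw, fm⟩, ?_, fun _ _ _ h => h⟩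
        rcases fm with fm | ⟨fm, fm'⟩
        · exact .inl fm
        · right
          rwa [fm, fm'] at w1)
  refine ⟨gw, ?_⟩
  rcases gm with gm | ⟨ga, gy⟩
  · exact .inl gm
  · right
    rw [gy]
    by_contra hpos
    obtain ⟨i, hi, u, hu, huy⟩ := h.tight y h.mem (Nat.pos_of_ne_zero hpos) le_rfl
    have huE := (h.isBase i hi).subset_ground hu.1
    rcases hG i hi u (hlt u huE) y (hlt y h.mem) with h' | h'
    · rw [gy] at h'
      exact lt_irrefl _ h'
    · exact h' ⟨rfl, huy, hu⟩

theorem run_walk (hE : M.E = Set.Iio n) {D c : ℕ → ℕ} {y₀ : ℕ} {s : State}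
    (h0 : s.reg 0 = n) (h1 : s.reg 1 = r) (hD : s.arr 2 = D)
    (h : WalkInv M r D c y₀ (rowSet n (s.arr 0)) (s.reg 10)) (hn : D (s.reg 10) ≤ n) :
    WalkInv M r D c y₀
        (rowSet n (((forto 9 0 (forArcs walkArc)).run (indepAsk M n) s).arr 0))
        (((forto 9 0 (forArcs walkArc)).run (indepAsk M n) s).reg 10) ∧
      D (((forto 9 0 (forArcs walkArc)).run (indepAsk M n) s).reg 10) = 0 := by
  have key := run_forto_induction (ask := indepAsk M n) (x := 9) (b := 0) (s := s)
    (p := forArcs walkArc)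
    (fun j t => WalkInv M r D c y₀ (rowSet n (t.arr 0)) (t.reg 10) ∧
      (D (t.reg 10) + j ≤ n ∨ D (t.reg 10) = 0)) rfl ⟨by simpa using h, by simp [hn]⟩ ?_
  · rw [h0] at key
    exact ⟨key.1, by omega⟩
  rintro j hj t e9 hreg harr ⟨ht1, ht2⟩
  obtain ⟨g1, g2⟩ := run_forArcs_walkArc hE (by rw [← h0]; exact hreg 0 rfl)
    (by rw [← h1]; exact hreg 1 rfl) (by rw [← hD]; exact harr 2 rfl) ht1
  simp only [State.arr_setReg, State.reg_setReg, ne_eq, show (10 : ℕ) ≠ 9 by norm_num,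
    not_false_eq_true, Function.update_of_ne]
  exact ⟨g1, by omega⟩

/-- The sum of the squares of the multiplicities of the rows of a matrix. -/
noncomputable def potential (n r : ℕ) (a : ℕ → ℕ) : ℕ :=
  ∑ v ∈ Finset.range n, mult (rowSet n a) r v ^ 2

theorem run_balanceLevel (hE : M.E = Set.Iio n) {s : State} (h0 : s.reg 0 = n)
    (h1 : s.reg 1 = r) (hS : ∀ i < r, M.IsBase (rowSet n (s.arr 0) i)) :
    (∀ i < r, M.IsBase (rowSet n ((balanceLevel.run (indepAsk M n) s).arr 0) i)) ∧
      (((balanceLevel.run (indepAsk M n) s).reg 12 ≠ 0 ∧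
          potential n r ((balanceLevel.run (indepAsk M n) s).arr 0) < potential n r (s.arr 0)) ∨
        ((balanceLevel.run (indepAsk M n) s).reg 12 = s.reg 12 ∧
          (balanceLevel.run (indepAsk M n) s).arr 0 = s.arr 0 ∧
          LevelBalanced M (rowSet n (s.arr 0)) r (s.reg 8 + 1))) := by
  classical
  set ask := indepAsk M n with hask
  have hV : M.E = (Finset.range n : Finset ℕ) := by rw [hE]; ext; simp
  have hlt : ∀ v ∈ M.E, v < n := fun v hv => by simpa [hE] using hv
  have hltE : ∀ v < n, v ∈ M.E := fun v hv => by simpa [hE] using hv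
  simp only [balanceLevel, run_seq]
  -- The multiplicities.
  have c3 := run_countMult (ask := ask) h0 h1
  set s₁ := countMult.run ask s with hs₁
  have r1 : ∀ y, countMult.writesReg y = false → s₁.reg y = s.reg y :=
    fun y hy => run_reg_of_writesReg hy s
  have a1 : s₁.arr 0 = s.arr 0 := run_arr_of_writesArr rfl s
  -- The initial labels.
  have c2 := run_initLabels (ask := ask) (s := s₁) ((r1 0 rfl).trans h0)
  set s₂ := initLabels.run ask s₁ with hs₂
  have r2 : ∀ y, initLabels.writesReg y = false → s₂.reg y = s₁.reg y :=
    fun y hy => run_reg_of_writesReg hy s₁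
  have a2 : s₂.arr 0 = s.arr 0 := (run_arr_of_writesArr rfl s₁).trans a1
  have a23 : s₂.arr 3 = s₁.arr 3 := run_arr_of_writesArr rfl s₁
  have c2' : ∀ v < n, s₂.arr 2 v =
      if s.reg 8 + 1 ≤ mult (rowSet n (s.arr 0)) r v then 0 else n + 1 := by
    intro v hv
    rw [c2 v hv, c3 v hv, r1 8 rfl]
  -- The labels.
  have hD₂ : BFSInv M (rowSet n (s₂.arr 0)) r n (s.reg 8 + 1) (s₂.arr 2) := by
    rw [a2]
    refine ⟨fun v hv => ?_, fun v hv => ?_, fun v hv hp hn => ?_⟩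
    · rw [c2' v (hlt v hv)]; split_ifs <;> omega
    · rw [c2' v (hlt v hv)]; split_ifs with h <;> simp [h]
    · rw [c2' v (hlt v hv)] at hp hn; split_ifs at hp hn <;> omega
  have h20 : s₂.reg 0 = n := (r2 0 rfl).trans ((r1 0 rfl).trans h0)
  have h21 : s₂.reg 1 = r := (r2 1 rfl).trans ((r1 1 rfl).trans h1)
  obtain ⟨l1, l2⟩ := run_labels hE h20 h21 (by rwa [a2]) hD₂ (fun v hv hn => by
    rw [c2' v (hlt v hv)] at hn ⊢; split_ifs at hn ⊢ <;> omega)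
  rw [← hask, a2] at l1 l2
  set s₃ := (forto 9 0 (forArcs labelArc)).run ask s₂ with hs₃
  have r3 : ∀ y, (forto 9 0 (forArcs labelArc)).writesReg y = false → s₃.reg y = s₂.reg y :=
    fun y hy => run_reg_of_writesReg hy s₂
  have a3 : s₃.arr 0 = s.arr 0 := (run_arr_of_writesArr rfl s₂).trans a2
  have a33 : s₃.arr 3 = s₁.arr 3 := (run_arr_of_writesArr rfl s₂).trans a23
  -- The end of the walk.
  have h30 : s₃.reg 0 = n := (r3 0 rfl).trans h20
  have h38 : s₃.reg 8 = s.reg 8 := (r3 8 rfl).trans ((r2 8 rfl).trans (r1 8 rfl))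
  obtain ⟨f1, f2⟩ := run_findEnd (ask := ask) h30
  rw [h38, a33] at f1 f2
  set s₄ := findEnd.run ask s₃ with hs₄
  have r4 : ∀ y, findEnd.writesReg y = false → s₄.reg y = s₃.reg y :=
    fun y hy => run_reg_of_writesReg hy s₃
  have a4 : s₄.arr 0 = s.arr 0 := (run_arr_of_writesArr rfl s₃).trans a3
  have a42 : s₄.arr 2 = s₃.arr 2 := run_arr_of_writesArr rfl s₃
  by_cases h11 : s₄.reg 11 = 0
  · rw [run_cond_of_eq_zero (b := .reg 11) h11, run_skip, a4]
    refine ⟨hS, .inr ⟨?_, rfl, l1.levelBalanced hS hV (by simp) l2 fun y hy hyn => ?_⟩⟩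
    · rw [r4 12 rfl, r3 12 rfl, r2 12 rfl, r1 12 rfl]
    · rw [← c3 y (hlt y hy)]
      exact f2 h11 y (hlt y hy) hyn
  · rw [run_cond_of_ne_zero (b := .reg 11) h11, run_seq, run_assign]
    obtain ⟨y1, y2, y3⟩ := f1 h11
    rw [c3 _ y1] at y2
    set y₀ := s₄.reg 10 with hy₀
    have hw : WalkInv M r (s₃.arr 2) (mult (rowSet n (s.arr 0)) r) y₀ (rowSet n (s₄.arr 0))
        (s₄.reg 10) := by
      rw [a4, ← hy₀]
      refine ⟨hS, l1.validLabel hS hV (by simp) l2, fun v hv hp hn => ?_, hltE _ y1, fun w => ?_⟩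
      · exact l1.tight v hv hp (hn.trans y3)
      · congr
    obtain ⟨w1, w2⟩ := run_walk hE ((r4 0 rfl).trans h30)
      ((r4 1 rfl).trans ((r3 1 rfl).trans h21)) a42 hw y3
    rw [← hask] at w1 w2
    refine ⟨w1.isBase, .inl ⟨by simp [Expr.eval], ?_⟩⟩
    refine w1.sum_sq_lt hV (by simpa using y1) ?_
    have := (l1.zero _ w1.mem).1 w2
    omega

theorem run_balanceAll (hE : M.E = Set.Iio n) {s : State} (h0 : s.reg 0 = n)
    (h1 : s.reg 1 = r) (hS : ∀ i < r, M.IsBase (rowSet n (s.arr 0) i)) :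
    (∀ i < r, M.IsBase (rowSet n ((balanceAll.run (indepAsk M n) s).arr 0) i)) ∧
      (((balanceAll.run (indepAsk M n) s).reg 12 ≠ 0 ∧
          potential n r ((balanceAll.run (indepAsk M n) s).arr 0) < potential n r (s.arr 0)) ∨
        ((balanceAll.run (indepAsk M n) s).reg 12 = 0 ∧
          ∀ k, 1 ≤ k → k ≤ r →
            LevelBalanced M (rowSet n ((balanceAll.run (indepAsk M n) s).arr 0)) r k)) := by
  have key := run_forto_induction (ask := indepAsk M n) (x := 8) (b := 1)
    (s := s.setReg 12 (Expr.eval s (.const 0))) (p := balanceLevel)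
    (fun j t => (∀ i < r, M.IsBase (rowSet n (t.arr 0) i)) ∧
      ((t.reg 12 ≠ 0 ∧ potential n r (t.arr 0) < potential n r (s.arr 0)) ∨
        (t.reg 12 = 0 ∧ t.arr 0 = s.arr 0 ∧
          ∀ k, 1 ≤ k → k ≤ j → LevelBalanced M (rowSet n (s.arr 0)) r k)))
    rfl ⟨hS, .inr ⟨by simp [Expr.eval], rfl, by omega⟩⟩ ?_
  · have e1 : (s.setReg 12 (Expr.eval s (.const 0))).reg 1 = r := by simpa using h1
    rw [e1] at key
    rw [balanceAll, run_seq, run_assign]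
    refine ⟨key.1, key.2.imp id fun h => ⟨h.1, ?_⟩⟩
    rw [h.2.1]
    exact h.2.2
  rintro j - t e8 hreg - ⟨ht1, ht2⟩
  obtain ⟨g1, g2⟩ := run_balanceLevel hE ((hreg 0 rfl).trans (by simpa using h0))
    ((hreg 1 rfl).trans (by simpa using h1)) ht1
  simp only [State.arr_setReg, State.reg_setReg, ne_eq, show (12 : ℕ) ≠ 8 by norm_num,
    not_false_eq_true, Function.update_of_ne]
  refine ⟨g1, ?_⟩
  rcases g2 with ⟨g2, g3⟩ | ⟨g2, g3, g4⟩
  · refine .inl ⟨g2, g3.trans_le ?_⟩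
    rcases ht2 with ht2 | ht2
    · exact ht2.2.le
    · rw [ht2.2.1]
  · rw [g2, g3]
    refine ht2.imp id fun h => ⟨h.1, h.2.1, fun k hk hkj => ?_⟩
    rcases Nat.lt_succ_iff_lt_or_eq.1 (Nat.lt_succ_of_le hkj) with hkj | rfl
    · exact h.2.2 k hk (by omega)
    · rw [e8, h.2.1] at g4
      exact g4

theorem suppSet_update_one {a : ℕ → ℕ} {j : ℕ} (hj : j < n) :
    suppSet n (Function.update a j 1) = insert j (suppSet n a) := by
  ext w
  rcases eq_or_ne w j with rfl | h
  · simp [suppSet, hj]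
  · simp [suppSet, h]

theorem run_greedyBase (hE : M.E = Set.Iio n) {s : State} (h0 : s.reg 0 = n)
    (hs : ∀ w, s.arr 1 w = 0) :
    M.IsBase (suppSet n ((greedyBase.run (indepAsk M n) s).arr 1)) := by
  have key := run_forto_induction (ask := indepAsk M n) (x := 5) (b := 0) (s := s)
    (p := .seq (.store 1 (.reg 5) (.const 1)) <| .seq (.query 7 1) <|
      .cond (.reg 7) .skip (.store 1 (.reg 5) (.const 0)))
    (fun j t => M.IsBasis (suppSet n (t.arr 1)) (Set.Iio j) ∧ ∀ w, j ≤ w → t.arr 1 w = 0)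
    rfl ?_ ?_
  · rw [h0, ← hE, Matroid.isBasis_ground_iff] at key
    exact key.1
  · have : suppSet n ((s.setReg 5 0).arr 1) = Set.Iio 0 := by
      ext w; simp [suppSet, hs]
    rw [this, show Set.Iio (0 : ℕ) = ∅ by ext; simp]
    exact ⟨M.empty_indep.isBasis_self, fun w _ => hs w⟩
  · rintro j hj t e5 hreg - ⟨ht1, ht2⟩
    rw [h0] at hj
    have hIio : Set.Iio (j + 1) = insert j (Set.Iio j) := by
      ext w; simp only [Set.mem_Iio, Set.mem_insert_iff]; omega
    have hjE : j ∈ M.E := by simpa [hE] using hj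
    have hjt : j ∉ suppSet n (t.arr 1) := fun h => h.2 (ht2 j le_rfl)
    rw [run_seq, run_store, run_seq]
    have hst : t.setCell 1 (Expr.eval t (.reg 5)) (Expr.eval t (.const 1)) = t.setCell 1 j 1 := by
      simp [Expr.eval, e5]
    rw [hst]
    have hq := run_query_reg_ne_zero (ask := indepAsk M n) 7 1 (t.setCell 1 j 1)
    set t₁ := (query 7 1).run (indepAsk M n) (t.setCell 1 j 1) with ht₁
    have b1 : t₁.arr 1 = Function.update (t.arr 1) j 1 := by
      rw [ht₁, run_query]; simp
    have b5 : t₁.reg 5 = j := by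
      rw [ht₁, run_query]; simpa using e5
    rw [State.arr_setCell, Function.update_self, indepAsk, suppSet_update_one hj] at hq
    by_cases hi : M.Indep (insert j (suppSet n (t.arr 1)))
    · rw [run_cond_of_ne_zero (b := .reg 7) (hq.2 hi), run_skip, State.arr_setReg, b1,
        suppSet_update_one hj, hIio]
      exact ⟨ht1.insert_isBasis_insert hi, fun w hw => by
        rw [Function.update_of_ne (by omega), ht2 w (by omega)]⟩
    · rw [run_cond_of_eq_zero (b := .reg 7) (by_contra fun h => hi (hq.1 h)), run_store,
        State.arr_setReg, State.arr_setCell]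
      have hz : Function.update (t₁.arr 1) (Expr.eval t₁ (.reg 5)) (Expr.eval t₁ (.const 0)) =
          t.arr 1 := by
        simp only [Expr.eval, b5, b1, Function.update_idem]
        rw [← ht2 j le_rfl, Function.update_eq_self]
      rw [Function.update_self, hz, hIio]
      refine ⟨ht1.indep.isBasis_of_forall_insert
        (ht1.subset.trans (Set.subset_insert _ _)) ?_, fun w hw => ht2 w (by omega)⟩
      rintro e ⟨rfl | he, he'⟩
      · exact ⟨hi, Set.insert_subset hjE ht1.indep.subset_ground⟩
      · exact ht1.insert_dep ⟨he, he'⟩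

theorem run_copyBase {ask : (ℕ → ℕ) → Prop} {s : State} (h0 : s.reg 0 = n) (h1 : s.reg 1 = r) :
    ∀ i < r, rowSet n ((copyBase.run ask s).arr 0) i = suppSet n (s.arr 1) := by
  have key := run_forRows_induction (ask := ask) (n := n) (r := r) (s := s)
    (p := .forto 5 0 <| .store 0 (.add (.reg 3) (.reg 5)) (.cell 1 (.reg 5)))
    (fun j t => t.arr 1 = s.arr 1 ∧ ∀ i < j, ∀ w < n, t.arr 0 (i * n + w) = s.arr 1 w)
    (by decide) (fun _ _ _ _ _ _ h => h) h0 h1 (by simp) ?_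
  · intro i hi
    ext w
    simp only [rowSet, suppSet, Set.mem_ofPred_eq]
    refine and_congr_right fun hw => ?_
    rw [copyBase, key.2 i hi w hw]
  rintro i hi t e0 - - e3 - ⟨ht1, ht2⟩
  have inner := run_forto_induction (ask := ask) (x := 5) (b := 0) (s := t)
    (p := .store 0 (.add (.reg 3) (.reg 5)) (.cell 1 (.reg 5)))
    (fun j t' => (∀ i' < i, ∀ w < n, t'.arr 0 (i' * n + w) = s.arr 1 w) ∧
      ∀ w < j, t'.arr 0 (i * n + w) = s.arr 1 w) rfl ⟨ht2, by simp⟩ ?_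
  · rw [e0] at inner
    refine ⟨(run_arr_of_writesArr rfl t).trans ht1, fun i' hi' w hw => ?_⟩
    rcases Nat.lt_succ_iff_lt_or_eq.1 hi' with hi' | rfl
    · exact inner.1 i' hi' w hw
    · exact inner.2 w hw
  rintro j - t' e5 hreg harr ⟨hr1, hr2⟩
  have g3 : t'.reg 3 = i * n := (hreg 3 rfl).trans e3
  have a1 : t'.arr 1 = s.arr 1 := (harr 1 rfl).trans ht1
  simp only [run_store, State.arr_setReg, State.arr_setCell, Function.update_self, Expr.eval, g3,
    e5, a1]
  constructor
  · intro i' hi' w hw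
    have : i' * n + n ≤ i * n := by
      rw [← Nat.succ_mul]; exact Nat.mul_le_mul_right n hi'
    rw [Function.update_of_ne (by omega), hr1 i' hi' w hw]
  · intro w hw
    rcases Nat.lt_succ_iff_lt_or_eq.1 hw with hw | rfl
    · rw [Function.update_of_ne (by omega), hr2 w hw]
    · rw [Function.update_self]

end Code

/-! ### The main loop -/

variable {n r : ℕ} {M : Matroid ℕ}

theorem potential_le (n r : ℕ) (a : ℕ → ℕ) : Code.potential n r a ≤ n * r ^ 2 := by
  refine (Finset.sum_le_card_nsmul _ _ (r ^ 2) fun v _ => ?_).trans (by simp)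
  exact Nat.pow_le_pow_left (mult_le _ _ _) 2

/-- The main loop halts, since the potential drops in every round but the last. -/
theorem exists_exec_loop (hE : M.E = Set.Iio n) {N Q : ℕ} (hn : n ≤ N) (hr : r ≤ N) (hQ : Q ≤ N) :
    ∀ m (s : State), s.reg 0 = n → s.reg 1 = r →
      (∀ i < r, M.IsBase (rowSet n (s.arr 0) i)) → s.reg 12 ≠ 0 →
      Code.potential n r (s.arr 0) ≤ m →
      ∃ s' t, Exec (Code.indepAsk M n) Q (.loop (.reg 12) Code.balanceAll.toProgram) s s' t ∧
        t ≤ (m + 1) * (Code.balanceAll.time.eval N + 2) + 2 ∧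
        (∀ i < r, M.IsBase (rowSet n (s'.arr 0) i)) ∧
        ∀ k, 1 ≤ k → k ≤ r → LevelBalanced M (rowSet n (s'.arr 0)) r k := by
  intro m
  induction m with
  | zero =>
    intro s h0 h1 hS h12 hm
    obtain ⟨t, ht, e⟩ := Code.exists_exec (ask := Code.indepAsk M n) (c := Code.balanceAll) rfl
      (h0 ▸ hn) (h1 ▸ hr) hQ
    obtain ⟨g1, g2 | ⟨g2, g3⟩⟩ := Code.run_balanceAll hE h0 h1 hS
    · omega
    · refine ⟨_, _, .loopTrue h12 e (.loopFalse g2), ?_, g1, g3⟩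
      simp only [Expr.cost]; omega
  | succ m ih =>
    intro s h0 h1 hS h12 hm
    obtain ⟨t, ht, e⟩ := Code.exists_exec (ask := Code.indepAsk M n) (c := Code.balanceAll) rfl
      (h0 ▸ hn) (h1 ▸ hr) hQ
    obtain ⟨g1, ⟨g2, g3⟩ | ⟨g2, g3⟩⟩ := Code.run_balanceAll hE h0 h1 hS
    · obtain ⟨s', t', e', ht', hS', hb⟩ := ih _
        ((Code.run_reg_of_writesReg rfl s).trans h0) ((Code.run_reg_of_writesReg rfl s).trans h1)
        g1 g2 (by omega)
      refine ⟨s', _, .loopTrue h12 e e', ?_, hS', hb⟩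
      simp only [Expr.cost]
      rw [Nat.succ_mul (m + 1)]
      omega
    · refine ⟨_, _, .loopTrue h12 e (.loopFalse g2), ?_, g1, g3⟩
      simp only [Expr.cost]
      rw [Nat.succ_mul (m + 1)]
      omega

/-- The initialization of `balanceProgram`. -/
def initCode : Code := .seq (.seq .greedyBase .copyBase) (.assign 12 (.const 1))

/-- A polynomial that bounds the running time of `balanceProgram`. -/
noncomputable def balanceTime : Polynomial ℕ :=
  initCode.time + ((.X ^ 3 + 1) * (Code.balanceAll.time + 2) + 2)

theorem exists_exec_balanceProgram (hE : M.E = Set.Iio n) (r Q : ℕ) :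
    ∃ s t, Exec (Code.indepAsk M n) Q balanceProgram (initial n r) s t ∧
      t ≤ balanceTime.eval (n + r + Q) ∧
      (∀ i < r, M.IsBase (rowSet n (s.arr 0) i)) ∧
      ∀ k, 1 ≤ k → k ≤ r → LevelBalanced M (rowSet n (s.arr 0)) r k := by
  set N := n + r + Q with hN
  have h0 : (initial n r).reg 0 = n := rfl
  have h1 : (initial n r).reg 1 = r := rfl
  obtain ⟨t₁, ht₁, e₁⟩ := Code.exists_exec (ask := Code.indepAsk M n) (c := initCode) (N := N)
    (Q := Q) rfl (s := initial n r) (by omega) (by omega) (by omega)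
  have hbase := Code.run_greedyBase hE h0 (fun _ => rfl)
  set s₁ := Code.greedyBase.run (Code.indepAsk M n) (initial n r) with hs₁
  have hcopy := Code.run_copyBase (ask := Code.indepAsk M n) (s := s₁)
    ((Code.run_reg_of_writesReg rfl _).trans h0) ((Code.run_reg_of_writesReg rfl _).trans h1)
  obtain ⟨s, t₂, e₂, ht₂, hS, hb⟩ := exists_exec_loop hE (N := N) (Q := Q) (r := r) (by omega)
    (by omega) (by omega) (n * r ^ 2) (initCode.run (Code.indepAsk M n) (initial n r))
    ((Code.run_reg_of_writesReg rfl _).trans h0) ((Code.run_reg_of_writesReg rfl _).trans h1)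
    (by
      intro i hi
      rw [← hcopy i hi] at hbase
      exact hbase)
    (by simp [initCode, Expr.eval]) (potential_le _ _ _)
  refine ⟨s, t₁ + t₂, .seq e₁ e₂, ?_, hS, hb⟩
  have hpot : n * r ^ 2 ≤ N ^ 3 := by
    calc n * r ^ 2 ≤ N * N ^ 2 := Nat.mul_le_mul (by omega) (Nat.pow_le_pow_left (by omega) 2)
      _ = N ^ 3 := by ring
  have hmul := Nat.mul_le_mul_right (Code.balanceAll.time.eval N + 2) (Nat.add_le_add_right hpot 1)
  simp only [balanceTime, Polynomial.eval_add, Polynomial.eval_mul, Polynomial.eval_pow,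
    Polynomial.eval_X, Polynomial.eval_one, Polynomial.eval_ofNat]
  omega

end OracleProgram

/-! ### Numbering the ground set -/

section Numbering

variable {α : Type*} {M : Matroid α} {n : ℕ}

open Classical in
/-- The number of an element of the ground set; it is `0` outside the ground set. -/
noncomputable def elementNumber (e : Fin n ≃ M.E) (x : α) : ℕ :=
  if h : x ∈ M.E then e.symm ⟨x, h⟩ else 0

theorem elementNumber_apply (e : Fin n ≃ M.E) (j : Fin n) : elementNumber e (e j : α) = j := by
  simp [elementNumber]

theorem injOn_elementNumber (e : Fin n ≃ M.E) : Set.InjOn (elementNumber e) M.E := by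
  intro x hx y hy h
  simp only [elementNumber, hx, hy, dif_pos] at h
  have := e.symm.injective (Fin.ext h)
  simpa using this

/-- The matroid on `0, …, n - 1` that is isomorphic to `M` by a numbering of the ground set. -/
noncomputable def numberMatroid (M : Matroid α) (e : Fin n ≃ M.E) : Matroid ℕ :=
  M.map (elementNumber e) (injOn_elementNumber e)

theorem numberMatroid_ground (e : Fin n ≃ M.E) : (numberMatroid M e).E = Set.Iio n := by
  ext j
  simp only [numberMatroid, Matroid.map_ground, Set.mem_image, Set.mem_Iio]
  constructor
  · rintro ⟨x, hx, rfl⟩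
    simp [elementNumber, hx]
  · intro hj
    exact ⟨e ⟨j, hj⟩, (e _).2, elementNumber_apply e _⟩

theorem decodeSet_subset (e : Fin n ≃ M.E) (a : ℕ → ℕ) : decodeSet e a ⊆ M.E := by
  rintro x ⟨j, rfl, -⟩
  exact (e j).2

theorem image_decodeSet (e : Fin n ≃ M.E) (a : ℕ → ℕ) :
    elementNumber e '' decodeSet e a = suppSet n a := by
  ext j
  constructor
  · rintro ⟨_, ⟨j, rfl, hj⟩, rfl⟩
    rw [elementNumber_apply]
    exact ⟨j.2, hj⟩
  · rintro ⟨hj, ha⟩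
    exact ⟨e ⟨j, hj⟩, ⟨⟨j, hj⟩, rfl, ha⟩, elementNumber_apply e _⟩

theorem independenceOracle_eq (e : Fin n ≃ M.E) :
    independenceOracle M e = OracleProgram.Code.indepAsk (numberMatroid M e) n := by
  funext a
  rw [independenceOracle, OracleProgram.Code.indepAsk, ← image_decodeSet e, numberMatroid,
    Matroid.map_image_indep_iff (decodeSet_subset e a)]

theorem dSum_image {r : ℕ} (e : Fin n ≃ M.E) (B : Fin r → Set α) (hB : ∀ i, B i ⊆ M.E) :
    dSum (fun i => elementNumber e '' B i) = dSum B := by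
  have hinj := injOn_elementNumber e
  have key : ∀ i j, (elementNumber e '' B i \ elementNumber e '' B j).ncard =
      (B i \ B j).ncard := by
    intro i j
    rw [← (hinj.mono (Set.sdiff_subset.trans (hB i))).ncard_image]
    congr 1
    ext x
    constructor
    · rintro ⟨⟨y, hy, rfl⟩, hx⟩
      exact ⟨y, ⟨hy, fun hyj => hx ⟨y, hyj, rfl⟩⟩, rfl⟩
    · rintro ⟨y, ⟨hy, hyj⟩, rfl⟩
      refine ⟨⟨y, hy, rfl⟩, ?_⟩
      rintro ⟨z, hz, hzy⟩
      exact hyj (hinj (hB j hz) (hB i hy) hzy ▸ hz)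
  simp only [dSum, key]

end Numbering

theorem mainTheorem2 :
    ∃ (P : OracleProgram.Program) (p : Polynomial ℕ),
      ∀ {α : Type*} (M : Matroid α) (n : ℕ) (e : Fin n ≃ M.E) (r Q : ℕ),
        ∃ (s : OracleProgram.State) (t : ℕ),
          OracleProgram.Exec (independenceOracle M e) Q P (OracleProgram.initial n r) s t ∧
          t ≤ p.eval (n + r + Q) ∧
          (∀ i, M.IsBase (outputSets e r (s.arr 0) i)) ∧
          ∀ B : Fin r → Set α, (∀ i, M.IsBase (B i)) →
            dSum B ≤ dSum (outputSets e r (s.arr 0)) := by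
  refine ⟨OracleProgram.balanceProgram, OracleProgram.balanceTime, fun {α} M n e r Q => ?_⟩
  have hE := numberMatroid_ground e
  have hV : (numberMatroid M e).E = (Finset.range n : Finset ℕ) := by rw [hE]; ext; simp
  obtain ⟨s, t, hex, ht, hS, hb⟩ := OracleProgram.exists_exec_balanceProgram hE r Q
  have hrow : ∀ i, elementNumber e '' outputSets e r (s.arr 0) i = rowSet n (s.arr 0) i :=
    fun i => image_decodeSet e _
  have hsub : ∀ i, outputSets e r (s.arr 0) i ⊆ M.E := fun i => decodeSet_subset e _
  refine ⟨s, t, by rwa [independenceOracle_eq], ht, fun i => ?_, fun B hB => ?_⟩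
  · have := hS i i.2
    rwa [← hrow i, numberMatroid, Matroid.map_image_isBase_iff (hsub i)] at this
  · -- Extend the numbered copy of `B` to a family indexed by all natural numbers.
    set T : ℕ → Set ℕ := fun i => if h : i < r then elementNumber e '' B ⟨i, h⟩ else ∅ with hT
    have hTB : ∀ i : Fin r, T i = elementNumber e '' B i := fun i => by simp [hT]
    have hTbase : ∀ i < r, (numberMatroid M e).IsBase (T i) := fun i hi => by
      rw [hTB ⟨i, hi⟩]
      exact (hB _).map _
    have h := dSum_le_of_sum_mult_sq_le hV hS hTbase
      (sum_mult_sq_le_of_balanced hV hS hTbase hb)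
    simp only [hTB, ← hrow] at h
    rwa [dSum_image e B fun i => (hB i).subset_ground, dSum_image e _ hsub] at h
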